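/- Let $M\subseteq\mathbb{R}^2$ be a connected smooth hypersurface, i.e. a connected one-dimensional embedded $C^\infty$ submanifold without boundary (not necessarily closed in $\mathbb{R}^2$). Suppose that $M$ is of finite type: at each of its points, $M$ has a finite order of contact with every affine line, that is, for every smooth regular local parametrization $\gamma$ of $M$, every parameter $t$, every $v\in\mathbb{R}^2\setminus\{0\}$ and every $c\in\mathbb{R}$, some derivative, of some order $k\ge 0$, of $s\mapsto\langle v,\gamma(s)\rangle-c$ does not vanish at $s=t$. (Real-analyticity is not assumed.) Let $\mu$ be a smooth measure on $M$, i.e. $\mu=\psi\sigma$, where $\sigma$ is the arc length measure on $M$ (the measure induced by Lebesgue measure) and $\psi:\mathbb{R}^2\to\mathbb{C}$ is a $C^\infty$ function whose support meets $M$ in a compact set. Then $\psi$ is $\sigma$-integrable, so that $\mu$ is a finite complex Borel measure, and its Weyl transform $W(\mu)$, the bounded operator on $L^2(\mathbb{R})$ given by $$W(\mu)=\int_{\mathbb{R}^2}\rho(x,y)\,d\mu(x,y),\qquad (\rho(x,y)\varphi)(t)=e^{\pi i(xy+2yt)}\varphi(t+x),$$ that is, $(W(\mu)\varphi)(t)=\int_{\mathbb{R}^2}e^{\pi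 i(xy+2yt)}\varphi(t+x)\,d\mu(x,y)$ for $\varphi\in L^2(\mathbb{R})$, is a compact operator. -/

import Mathlib

open MeasureTheory Filter Topology
open scoped ENNReal ContDiff

/-! ### The Schrödinger representation on `L²(ℝ)` -/

/-- The Euclidean plane `ℝ²`; a point `p` has the coordinates `p 0` and `p 1`. -/
abbrev Plane : Type := EuclideanSpace ℝ (Fin 2)

/-- The Hilbert space `L²(ℝ)` of complex-valued functions. -/
abbrev L2R : Type := Lp ℂ 2 (volume : Measure ℝ)

/-- The unimodular factor `e^{πi(xy + 2yt)}`, where `p = (x, y)`. -/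
noncomputable def weylPhase (p : Plane) (t : ℝ) : ℂ :=
  Complex.exp (((Real.pi * (p 0 * p 1 + 2 * p 1 * t) : ℝ) : ℂ) * Complex.I)

theorem norm_weylPhase (p : Plane) (t : ℝ) : ‖weylPhase p t‖ = 1 :=
  Complex.norm_exp_ofReal_mul_I _

theorem continuous_weylPhase_right (p : Plane) : Continuous (weylPhase p) := by
  unfold weylPhase; fun_prop

theorem continuous_weylPhase_left (t : ℝ) : Continuous fun p => weylPhase p t := by
  unfold weylPhase; fun_prop

theorem memLp_weylPhase_mul (p : Plane) {f : ℝ → ℂ} (hf : MemLp f 2 volume) :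
    MemLp (fun t => weylPhase p t * f t) 2 volume := by
  refine hf.of_le ((continuous_weylPhase_right p).aestronglyMeasurable.mul
    hf.aestronglyMeasurable) (Eventually.of_forall fun t => ?_)
  simp [norm_weylPhase]

theorem memLp_schrodinger (p : Plane) (φ : L2R) :
    MemLp (fun t => weylPhase p t * φ (t + p 0)) 2 volume :=
  memLp_weylPhase_mul p
    ((Lp.memLp φ).comp_measurePreserving (measurePreserving_add_right volume (p 0)))

/-- The operator `ρ(x, y, 1)` on `L²(ℝ)`: `(ρ(x, y, 1) φ)(t) = e^{πi(xy + 2yt)} φ(t + x)`. -/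
noncomputable def schrodinger (p : Plane) (φ : L2R) : L2R :=
  (memLp_schrodinger p φ).toLp _

theorem coeFn_schrodinger (p : Plane) (φ : L2R) :
    schrodinger p φ =ᵐ[volume] fun t => weylPhase p t * φ (t + p 0) :=
  MemLp.coeFn_toLp _

theorem schrodinger_add (p : Plane) (φ χ : L2R) :
    schrodinger p (φ + χ) = schrodinger p φ + schrodinger p χ := by
  apply Lp.ext
  have h := (measurePreserving_add_right (volume : Measure ℝ) (p 0)).quasiMeasurePreserving.ae
    (Lp.coeFn_add φ χ)
  filter_upwards [coeFn_schrodinger p (φ + χ), coeFn_schrodinger p φ, coeFn_schrodinger p χ,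
    Lp.coeFn_add (schrodinger p φ) (schrodinger p χ), h] with t h1 h2 h3 h4 h5
  rw [h1, h4, Pi.add_apply, h2, h3, h5, Pi.add_apply, mul_add]

theorem schrodinger_smul (p : Plane) (c : ℂ) (φ : L2R) :
    schrodinger p (c • φ) = c • schrodinger p φ := by
  apply Lp.ext
  have h := (measurePreserving_add_right (volume : Measure ℝ) (p 0)).quasiMeasurePreserving.ae
    (Lp.coeFn_smul c φ)
  filter_upwards [coeFn_schrodinger p (c • φ), coeFn_schrodinger p φ,
    Lp.coeFn_smul c (schrodinger p φ), h] with t h1 h2 h3 h4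
  rw [h1, h3, Pi.smul_apply, h2, h4, Pi.smul_apply, smul_eq_mul, smul_eq_mul]
  ring

theorem norm_schrodinger (p : Plane) (φ : L2R) : ‖schrodinger p φ‖ = ‖φ‖ := by
  have hT := measurePreserving_add_right (volume : Measure ℝ) (p 0)
  rw [← Lp.norm_compMeasurePreserving φ hT, Lp.norm_def, Lp.norm_def]
  congr 1
  apply eLpNorm_congr_norm_ae
  filter_upwards [coeFn_schrodinger p φ, Lp.coeFn_compMeasurePreserving φ hT] with t h1 h2
  rw [h1, h2, norm_mul, norm_weylPhase, one_mul, Function.comp_apply]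

theorem schrodinger_sub (p : Plane) (φ χ : L2R) :
    schrodinger p (φ - χ) = schrodinger p φ - schrodinger p χ := by
  have h := schrodinger_add p (φ - χ) χ
  rw [sub_add_cancel] at h
  rw [h, add_sub_cancel_right]

theorem tendsto_phase_mul (q : Plane) {f : ℝ → ℂ} (hf : MemLp f 2 volume) :
    Tendsto (fun p => eLpNorm (fun t => weylPhase p t * f t - weylPhase q t * f t) 2 volume)
      (𝓝 q) (𝓝 0) := by
  have key : Tendsto (fun p => ∫⁻ t, ‖weylPhase p t * f t - weylPhase q t * f t‖ₑ ^ (2 : ℝ))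
      (𝓝 q) (𝓝 (∫⁻ _ : ℝ, 0)) := by
    refine tendsto_lintegral_filter_of_dominated_convergence'
      (fun t => (2 * ‖f t‖ₑ) ^ (2 : ℝ)) ?_ ?_ ?_ ?_
    · exact Eventually.of_forall fun p =>
        (((memLp_weylPhase_mul p hf).sub (memLp_weylPhase_mul q hf)).aestronglyMeasurable.enorm).pow_const _
    · refine Eventually.of_forall fun p => Eventually.of_forall fun t => ?_
      have : ‖weylPhase p t * f t - weylPhase q t * f t‖ₑ ≤ 2 * ‖f t‖ₑ := by
        refine (enorm_sub_le).trans ?_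
        have e : ∀ r, ‖weylPhase r t * f t‖ₑ = ‖f t‖ₑ := fun r => by
          rw [← ofReal_norm, ← ofReal_norm, norm_mul, norm_weylPhase, one_mul]
        rw [e, e, two_mul]
      exact ENNReal.rpow_le_rpow this (by norm_num)
    · have h2 := (hf.const_mul (2 : ℂ)).eLpNorm_lt_top
      rw [eLpNorm_lt_top_iff_lintegral_rpow_enorm_lt_top (by norm_num) (by norm_num)] at h2
      have e : ∀ t, ‖(2 : ℂ) * f t‖ₑ = 2 * ‖f t‖ₑ := fun t => by
        rw [enorm_mul]; congr 1
        rw [← ofReal_norm]; norm_num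
      simp only [e, ENNReal.toReal_ofNat] at h2
      exact h2.ne
    · refine Eventually.of_forall fun t => ?_
      have hc : Continuous fun p => ‖weylPhase p t * f t - weylPhase q t * f t‖ₑ ^ (2 : ℝ) := by
        have := continuous_weylPhase_left t
        exact ENNReal.continuous_rpow_const.comp (by fun_prop)
      simpa using hc.tendsto q
  have h3 := (ENNReal.continuous_rpow_const (y := (1 / 2 : ℝ))).tendsto _ |>.comp key
  simp only [lintegral_zero] at h3
  rw [ENNReal.zero_rpow_of_pos (by norm_num)] at h3
  refine h3.congr fun p => ?_
  rw [eLpNorm_eq_lintegral_rpow_enorm_toReal (by norm_num) (by norm_num)]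
  simp

/-- Strong continuity of the representation. -/
theorem continuous_schrodinger (φ : L2R) : Continuous fun p => schrodinger p φ := by
  refine continuous_iff_continuousAt.2 fun q => ?_
  let T : ℝ → L2R := fun x =>
    Lp.compMeasurePreserving (· + x) (measurePreserving_add_right volume x) φ
  have hT : Continuous T := by
    let g : C(ℝ, C(ℝ, ℝ)) := (ContinuousMap.mk (fun a : ℝ × ℝ => a.2 + a.1) (by fun_prop)).curry
    exact (continuous_const (y := φ)).compMeasurePreservingLp g.continuous
      (fun x => measurePreserving_add_right volume x) (by norm_num)
  let M : Plane → L2R → L2R := fun p f => (memLp_weylPhase_mul p (Lp.memLp f)).toLp _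
  have hM : ∀ p f, M p f =ᵐ[volume] fun t => weylPhase p t * f t := fun p f => MemLp.coeFn_toLp _
  have hMT : ∀ p, schrodinger p φ = M p (T (p 0)) := by
    intro p
    apply Lp.ext
    filter_upwards [coeFn_schrodinger p φ, hM p (T (p 0)), Lp.coeFn_compMeasurePreserving φ
      (measurePreserving_add_right volume (p 0))] with t h1 h2 h3
    rw [h1, h2, h3, Function.comp_apply]
  have hMn : ∀ p f g, dist (M p f) (M p g) = dist f g := by
    intro p f g
    rw [dist_eq_norm, dist_eq_norm, Lp.norm_def, Lp.norm_def]
    congr 1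
    apply eLpNorm_congr_norm_ae
    filter_upwards [hM p f, hM p g, Lp.coeFn_sub f g, Lp.coeFn_sub (M p f) (M p g)]
      with t h1 h2 h3 h4
    rw [h4, h3, Pi.sub_apply, Pi.sub_apply, h1, h2, ← mul_sub, norm_mul, norm_weylPhase, one_mul]
  have h1 : Tendsto (fun p : Plane => dist (T (p 0)) (T (q 0))) (𝓝 q) (𝓝 0) := by
    have : Continuous fun p : Plane => dist (T (p 0)) (T (q 0)) :=
      (hT.comp (by fun_prop)).dist continuous_const
    simpa using this.tendsto q
  have h2 : Tendsto (fun p => dist (M p (T (q 0))) (M q (T (q 0)))) (𝓝 q) (𝓝 0) := by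
    have h := (ENNReal.tendsto_toReal ENNReal.zero_ne_top).comp
      (tendsto_phase_mul q (Lp.memLp (T (q 0))))
    rw [ENNReal.toReal_zero] at h
    refine h.congr fun p => ?_
    rw [dist_eq_norm, Lp.norm_def, Function.comp_apply]
    congr 1
    apply eLpNorm_congr_ae
    filter_upwards [hM p (T (q 0)), hM q (T (q 0)),
      Lp.coeFn_sub (M p (T (q 0))) (M q (T (q 0)))] with t h1 h2 h3
    rw [h3, Pi.sub_apply, h1, h2]
  refine tendsto_iff_dist_tendsto_zero.2 ?_
  refine squeeze_zero (fun _ => dist_nonneg) (fun p => ?_) (by simpa using h1.add h2)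
  simp only [hMT]
  refine (dist_triangle _ (M p (T (q 0))) _).trans ?_
  rw [hMn]

/-! ### The Weyl transform of a complex Borel measure -/

/-- A complex measure has finite total variation. -/
theorem isFiniteMeasure_variation {X : Type*} [MeasurableSpace X] (mu : ComplexMeasure X) :
    IsFiniteMeasure mu.variation := by
  have h : mu.variation ≤ (ComplexMeasure.re mu).totalVariation +
      (ComplexMeasure.im mu).totalVariation := by
    refine VectorMeasure.variation_le_of_forall_enorm_le fun E _ => ?_
    have e : mu E = ((ComplexMeasure.re mu E : ℝ) : ℂ) +
        ((ComplexMeasure.im mu E : ℝ) : ℂ) * Complex.I :=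
      (Complex.re_add_im (mu E)).symm
    rw [e, Measure.add_apply]
    refine (enorm_add_le _ _).trans (add_le_add ?_ ?_)
    · refine le_trans (le_of_eq ?_) (SignedMeasure.enorm_le_totalVariation _ E)
      rw [← ofReal_norm, ← ofReal_norm, Complex.norm_real]
    · refine le_trans (le_of_eq ?_) (SignedMeasure.enorm_le_totalVariation _ E)
      rw [← ofReal_norm, ← ofReal_norm, norm_mul, Complex.norm_I, mul_one, Complex.norm_real]
  have hf : ∀ s : SignedMeasure X, IsFiniteMeasure s.totalVariation := fun s => by
    unfold SignedMeasure.totalVariation; infer_instance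
  have := hf (ComplexMeasure.re mu)
  have := hf (ComplexMeasure.im mu)
  exact isFiniteMeasure_of_le _ h

theorem integrable_schrodinger (mu : ComplexMeasure Plane) (φ : L2R) :
    mu.Integrable fun p => schrodinger p φ := by
  have := isFiniteMeasure_variation mu
  exact Integrable.of_bound (continuous_schrodinger φ).aestronglyMeasurable ‖φ‖
    (Eventually.of_forall fun p => (norm_schrodinger p φ).le)

/-- The pairing `(f, c) ↦ c • f` of `L²(ℝ)` with `ℂ`. -/
noncomputable def scalarPairing : L2R →L[ℝ] ℂ →L[ℝ] L2R :=
  (ContinuousLinearMap.lsmul ℝ ℂ).flip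

/-- The Weyl transform of a complex Borel measure `mu` on the plane, the bounded operator
`W(mu) = ∫ ρ(x, y, 1) dmu(x, y)` on `L²(ℝ)`, that is
`(W(mu) φ)(t) = ∫ e^{πi(xy + 2yt)} φ(t + x) dmu(x, y)`. -/
noncomputable def weylTransform (mu : ComplexMeasure Plane) : L2R →L[ℂ] L2R :=
  LinearMap.mkContinuous
    { toFun := fun φ => mu.integral (fun p => schrodinger p φ) scalarPairing
      map_add' := fun φ χ => by
        simp only [schrodinger_add]
        exact VectorMeasure.integral_fun_add (integrable_schrodinger mu φ)
          (integrable_schrodinger mu χ)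
      map_smul' := fun c φ => by
        simp only [schrodinger_smul, RingHom.id_apply]
        refine setToFun_smul (𝕜 := ℂ) _ (fun c s f => ?_) c (fun p => schrodinger p φ)
        exact smul_comm (mu s) c f }
    (‖scalarPairing‖ * mu.variation.real Set.univ)
    fun φ => by
      have := isFiniteMeasure_variation mu
      refine (VectorMeasure.norm_integral_le_of_norm_le_const (C := ‖φ‖)
        (Eventually.of_forall fun p => (norm_schrodinger p φ).le)).trans (le_of_eq ?_)
      ring

/-! ### Smooth curves of finite type and smooth measures -/

/-- `γ`, restricted to the open set `I ⊆ ℝ`, is a smooth regular parametrization of a relatively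
open part of `M`, and a homeomorphism onto it. -/
structure IsLocalParametrization (M : Set Plane) (I : Set ℝ) (γ : ℝ → Plane) : Prop where
  isOpen_domain : IsOpen I
  contDiffOn : ContDiffOn ℝ ∞ γ I
  deriv_ne_zero : ∀ t ∈ I, deriv γ t ≠ 0
  isEmbedding : IsEmbedding fun t : I => γ t
  isOpen_image : ∃ V : Set Plane, IsOpen V ∧ γ '' I = M ∩ V

/-- `M` is a smooth hypersurface of the plane, i.e. a one-dimensional embedded smooth submanifold
(without boundary, not necessarily closed in the plane). -/
def IsSmoothCurve (M : Set Plane) : Prop :=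
  ∀ p ∈ M, ∃ (I : Set ℝ) (γ : ℝ → Plane), IsLocalParametrization M I γ ∧ p ∈ γ '' I

/-- `M` is of finite type: at each of its points `γ t`, it has finite order of contact with every
affine line `{q | ⟪v, q⟫ = c}`, `v ≠ 0`. -/
def IsFiniteType (M : Set Plane) : Prop :=
  ∀ (I : Set ℝ) (γ : ℝ → Plane), IsLocalParametrization M I γ → ∀ t ∈ I,
    ∀ (v : Plane) (c : ℝ), v ≠ 0 →
      ∃ k : ℕ, iteratedDeriv k (fun s => inner ℝ v (γ s) - c) t ≠ 0

/-- The measure on a curve `M` induced by the Lebesgue measure of the plane: arc length, i.e. the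
one-dimensional Hausdorff measure on `M`. -/
noncomputable def arcLength (M : Set Plane) : Measure Plane :=
  (Measure.hausdorffMeasure 1 : Measure Plane).restrict M

/-- The complex measure `ψσ` on the plane, where `σ` is arc length on `M`
(for `ψ` integrable with respect to `σ`). -/
noncomputable def densityMeasure (M : Set Plane) (ψ : Plane → ℂ) : ComplexMeasure Plane :=
  (arcLength M).withDensityᵥ ψ

/-! Let `T` be the Weyl transform. It is compact as soon as `T* T` is, and by the cocycle identity
of the representation `T* T` superposes the operators `ρ(q - p)` over pairs of points of the curve,
with weight `twist p q * (conj (ψ p) * ψ q)` (`adjoint_superposition_comp`).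

The heart of the matter is that `q - p` has an absolutely continuous distribution in the plane
(`IsFiniteType.map_difference_absolutelyContinuous`). Finite type allows the tangent to have a given
direction only at isolated parameters, so by Fubini almost every pair of tangents is transverse. At
a transverse pair, `(s, t) ↦ γ₂ t - γ₁ s` is a local diffeomorphism and pulls null sets back to null
sets.

Hence `T* T` is a limit of Weyl transforms of integrable functions on the plane. These are compact:
the operator norm is at most the `L¹` norm, and the indicator of a rectangle gives a Hilbert–Schmidt
operator. No decay of the Fourier transform of the measure is needed. -/

section Compactness

/-! ### Compactness criteria in Hilbert space -/

variable {H : Type*} [NormedAddCommGroup H] [InnerProductSpace ℂ H]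

theorem isCompactOperator_smulRight (f : H →L[ℂ] ℂ) (x : H) :
    IsCompactOperator (f.smulRight x) := by
  have h : IsCompactOperator (ContinuousLinearMap.id ℂ ℂ) := by
    refine ⟨Metric.closedBall 0 1, isCompact_closedBall 0 1, ?_⟩
    exact Metric.closedBall_mem_nhds 0 one_pos
  have h2 := (h.comp_clm f).clm_comp ((ContinuousLinearMap.id ℂ ℂ).smulRight x)
  convert! h2 using 1

variable [CompleteSpace H]

/-- A Hilbert–Schmidt operator is compact. -/
theorem isCompactOperator_of_sum_norm_sq_le {ι : Type*} (b : HilbertBasis ι ℂ H) (T : H →L[ℂ] H)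
    (C : ℝ) (hT : ∀ s : Finset ι, ∑ i ∈ s, ‖T (b i)‖ ^ 2 ≤ C) : IsCompactOperator T := by
  classical
  have hsum : Summable fun i => ‖T (b i)‖ ^ 2 :=
    summable_of_sum_le (fun i => sq_nonneg _) hT
  -- `F s` is `T` after the orthogonal projection onto the span of `b i`, `i ∈ s`. Bessel and
  -- Cauchy–Schwarz bound `‖T - F s‖` by the square root of the tail of `∑ ‖T (b i)‖ ^ 2`.
  let F : Finset ι → H →L[ℂ] H := fun s =>
    ∑ i ∈ s, (innerSL ℂ (b i)).smulRight (T (b i))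
  have hF : ∀ s φ, F s φ = ∑ i ∈ s, inner ℂ (b i) φ • T (b i) := fun s φ => by
    simp [F]
  have hcomp : ∀ s, IsCompactOperator (F s) := fun s => by
    have : F s ∈ compactOperator (RingHom.id ℂ) H H :=
      Submodule.sum_mem _ fun i _ => isCompactOperator_smulRight _ _
    exact this
  refine isCompactOperator_of_tendsto (l := atTop) (F := F) ?_ (Eventually.of_forall hcomp)
  rw [Metric.tendsto_atTop]
  intro ε hε
  obtain ⟨s₀, hs₀⟩ := summable_iff_vanishing_norm.1 hsum ((ε / 2) ^ 2) (by positivity)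
  refine ⟨s₀, fun s hs => ?_⟩
  rw [dist_comm, dist_eq_norm]
  refine lt_of_le_of_lt (ContinuousLinearMap.opNorm_le_bound _ (M := ε / 2) (by positivity)
    fun φ => ?_) (half_lt_self hε)
  have h1 : HasSum (fun i => inner ℂ (b i) φ • T (b i)) (T φ) := by
    have := (b.hasSum_repr φ).mapL T
    simpa [b.repr_apply_apply] using this
  -- Passing to finite `t ⊇ s` leaves only finite sums over `t \ s` to estimate.
  have h2 : Tendsto (fun t : Finset ι => ‖∑ i ∈ t, inner ℂ (b i) φ • T (b i) - F s φ‖) atTop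
      (𝓝 ‖T φ - F s φ‖) := (Tendsto.sub_const h1 _).norm
  refine le_of_tendsto h2 ?_
  filter_upwards [eventually_ge_atTop s] with t ht
  rw [hF, ← Finset.sum_sdiff (show s ⊆ t from ht), add_sub_cancel_right]
  have hb : ∑ i ∈ t \ s, ‖inner ℂ (b i) φ‖ ^ 2 ≤ ‖φ‖ ^ 2 :=
    b.orthonormal.sum_inner_products_le φ
  have ha : ∑ i ∈ t \ s, ‖T (b i)‖ ^ 2 ≤ (ε / 2) ^ 2 := by
    have := hs₀ (t \ s) (Finset.disjoint_left.2 fun i hi hi' => (Finset.mem_sdiff.1 hi).2 (hs hi'))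
    exact ((le_abs_self _).trans_lt this).le
  have hcs := Finset.sum_mul_sq_le_sq_mul_sq (t \ s) (fun i => ‖inner ℂ (b i) φ‖)
    (fun i => ‖T (b i)‖)
  have h3 : ‖∑ i ∈ t \ s, inner ℂ (b i) φ • T (b i)‖
      ≤ ∑ i ∈ t \ s, ‖inner ℂ (b i) φ‖ * ‖T (b i)‖ := by
    refine (norm_sum_le _ _).trans (le_of_eq ?_)
    simp [norm_smul]
  refine h3.trans (abs_le_of_sq_le_sq' ?_ (by positivity)).2
  refine hcs.trans ?_
  rw [mul_pow, mul_comm]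
  exact mul_le_mul ha hb (Finset.sum_nonneg fun _ _ => sq_nonneg _) (by positivity)

/-- If `T* T` is compact, then so is `T`. -/
theorem isCompactOperator_of_adjoint_comp (T : H →L[ℂ] H)
    (h : IsCompactOperator (ContinuousLinearMap.adjoint T ∘L T)) : IsCompactOperator T := by
  change IsCompactOperator (T : H →ₗ[ℂ] H)
  rw [isCompactOperator_iff_isCompact_closure_image_closedBall (T : H →ₗ[ℂ] H) one_pos]
  refine TotallyBounded.isCompact_of_isClosed (TotallyBounded.closure ?_) isClosed_closure
  rw [Metric.totallyBounded_iff]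
  intro ε hε
  have hK : TotallyBounded ((ContinuousLinearMap.adjoint T ∘L T) '' Metric.closedBall 0 1) :=
    (IsCompactOperator.isCompact_closure_image_closedBall
      (f := (↑(ContinuousLinearMap.adjoint T ∘L T) : H →ₗ[ℂ] H)) h 1).totallyBounded.subset
      subset_closure
  -- Differences in the unit ball have norm at most 2, so `‖T (x - g y)‖ ^ 2 = ⟪T* T (x - g y), x -
  -- g y⟫ ≤ 2 * (ε ^ 2 / 8)`. The net is taken inside the image, so that its points have preimages
  -- `g y` in the ball.
  obtain ⟨t, ht, htf, hcov⟩ := totallyBounded_iff_subset.1 hK {p | dist p.1 p.2 < ε ^ 2 / 8}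
    (Metric.dist_mem_uniformity (by positivity))
  choose! g hg hgt using fun y (hy : y ∈ t) => ht hy
  refine ⟨(fun y => T (g y)) '' t, htf.image _, ?_⟩
  rintro _ ⟨x, hx, rfl⟩
  obtain ⟨y, hy, hxy⟩ := Set.mem_iUnion₂.1 (hcov ⟨x, hx, rfl⟩)
  refine Set.mem_iUnion₂.2 ⟨_, ⟨y, hy, rfl⟩, ?_⟩
  rw [Metric.mem_ball, dist_eq_norm]
  have e : ‖T x - T (g y)‖ ^ 2 < ε ^ 2 := by
    rw [← map_sub, ContinuousLinearMap.apply_norm_sq_eq_inner_adjoint_left]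
    have hd : ‖(ContinuousLinearMap.adjoint T ∘L T) (x - g y)‖ < ε ^ 2 / 8 := by
      rw [map_sub, ← dist_eq_norm]
      have := hgt y hy
      simp only [Set.mem_ofPred_eq] at hxy
      rw [← this] at hxy
      exact hxy
    have h2 : ‖x - g y‖ ≤ 2 := by
      refine (norm_sub_le _ _).trans ?_
      have h3 := mem_closedBall_zero_iff.1 hx
      have h4 := mem_closedBall_zero_iff.1 (hg y hy)
      linarith
    calc _ ≤ ‖inner ℂ ((ContinuousLinearMap.adjoint T ∘L T) (x - g y)) (x - g y)‖ :=
          Complex.re_le_norm _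
      _ ≤ ‖(ContinuousLinearMap.adjoint T ∘L T) (x - g y)‖ * ‖x - g y‖ := norm_inner_le_norm _ _
      _ ≤ (ε ^ 2 / 8) * 2 := by gcongr
      _ < ε ^ 2 := by nlinarith [sq_pos_of_pos hε]
  exact (abs_lt_of_sq_lt_sq' e hε.le).2

end Compactness

/-! ### Superpositions of the operators `ρ(p)` -/

section Superposition

variable {Z : Type*} [MeasurableSpace Z] {m : Measure Z} {δ : Z → Plane} {c c' : Z → ℂ}

theorem integrable_smul_schrodinger (hδ : Measurable δ) (hc : Integrable c m) (φ : L2R) :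
    Integrable (fun z => c z • schrodinger (δ z) φ) m := by
  refine (hc.norm.mul_const ‖φ‖).mono' (hc.aestronglyMeasurable.smul
    ((continuous_schrodinger φ).stronglyMeasurable.comp_measurable hδ).aestronglyMeasurable)
    (Eventually.of_forall fun z => ?_)
  rw [norm_smul, norm_schrodinger]

/-- The operator `∫ c(z) ρ(δ(z)) dm(z)`. -/
noncomputable def superposition (hδ : Measurable δ) (hc : Integrable c m) : L2R →L[ℂ] L2R :=
  LinearMap.mkContinuous
    { toFun := fun φ => ∫ z, c z • schrodinger (δ z) φ ∂m
      map_add' := fun φ χ => by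
        simp only [schrodinger_add, smul_add]
        exact integral_add (integrable_smul_schrodinger hδ hc φ)
          (integrable_smul_schrodinger hδ hc χ)
      map_smul' := fun a φ => by
        simp only [schrodinger_smul, RingHom.id_apply]
        rw [← integral_smul]
        exact integral_congr_ae (Eventually.of_forall fun z => smul_comm _ _ _) }
    (∫ z, ‖c z‖ ∂m)
    fun φ => by
      refine (norm_integral_le_integral_norm _).trans (le_of_eq ?_)
      simp only [norm_smul, norm_schrodinger]
      exact integral_mul_const _ _

theorem superposition_apply (hδ : Measurable δ) (hc : Integrable c m) (φ : L2R) :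
    superposition hδ hc φ = ∫ z, c z • schrodinger (δ z) φ ∂m := rfl

theorem superposition_congr (hδ : Measurable δ) (hc : Integrable c m) (hc' : Integrable c' m)
    (h : c =ᵐ[m] c') : superposition hδ hc = superposition hδ hc' := by
  ext1 φ
  refine integral_congr_ae ?_
  filter_upwards [h] with z hz
  rw [hz]

theorem superposition_add (hδ : Measurable δ) (hc : Integrable c m) (hc' : Integrable c' m) :
    superposition hδ (hc.add hc') = superposition hδ hc + superposition hδ hc' := by
  ext1 φ
  rw [add_apply]
  simp only [superposition_apply, Pi.add_apply, add_smul]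
  exact integral_add (integrable_smul_schrodinger hδ hc φ) (integrable_smul_schrodinger hδ hc' φ)

theorem superposition_smul (hδ : Measurable δ) (hc : Integrable c m) (a : ℂ) :
    superposition hδ (hc.smul a) = a • superposition hδ hc := by
  ext1 φ
  rw [smul_apply]
  simp only [superposition_apply, Pi.smul_apply, smul_assoc]
  exact integral_smul _ _

theorem norm_superposition_le (hδ : Measurable δ) (hc : Integrable c m) :
    ‖superposition hδ hc‖ ≤ ∫ z, ‖c z‖ ∂m :=
  LinearMap.mkContinuous_norm_le _ (integral_nonneg fun _ => norm_nonneg _) _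

theorem norm_superposition_sub_le (hδ : Measurable δ) (hc : Integrable c m)
    (hc' : Integrable c' m) :
    ‖superposition hδ hc - superposition hδ hc'‖ ≤ ∫ z, ‖c z - c' z‖ ∂m := by
  have : superposition hδ hc - superposition hδ hc' = superposition hδ (hc.sub hc') := by
    rw [sub_eq_iff_eq_add, ← superposition_add]
    congr 1
    simp
  rw [this]
  exact norm_superposition_le _ _

theorem continuous_superposition (hδ : Measurable δ) :
    Continuous fun f : Z →₁[m] ℂ => superposition hδ (L1.integrable_coeFn f) := by
  refine LipschitzWith.continuous (K := 1) (LipschitzWith.of_dist_le_mul fun f g => ?_)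
  rw [dist_eq_norm, NNReal.coe_one, one_mul, L1.dist_eq_integral_dist]
  simpa only [dist_eq_norm] using norm_superposition_sub_le hδ _ _

/-- Compactness of the operators `∫ c(z) ρ(δ(z)) dm(z)` can be tested on indicators `c`. -/
theorem isCompactOperator_superposition_of_indicator (hδ : Measurable δ)
    (h : ∀ E : Set Z, MeasurableSet E → m E ≠ ⊤ →
      ∀ hE : Integrable (E.indicator fun _ => (1 : ℂ)) m, IsCompactOperator (superposition hδ hE))
    (hc : Integrable c m) : IsCompactOperator (superposition hδ hc) := by
  refine Integrable.induction (μ := m)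
    (fun c => ∀ hc : Integrable c m, IsCompactOperator (superposition hδ hc)) ?_ ?_ ?_ ?_ hc hc
  · intro a E hE hfin hc
    have hi : Integrable (E.indicator fun _ => (1 : ℂ)) m :=
      (integrable_indicator_iff hE).2 (integrableOn_const hfin.ne)
    have : superposition hδ hc = a • superposition hδ hi := by
      rw [← superposition_smul]
      refine superposition_congr _ _ _ (Eventually.of_forall fun z => ?_)
      by_cases hz : z ∈ E <;> simp [hz]
    rw [this]
    exact (h E hE hfin.ne hi).smul a
  · intro f g _ hf hg Pf Pg hfg
    rw [superposition_congr hδ hfg (hf.add hg) (ae_eq_refl _), superposition_add hδ hf hg]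
    exact (Pf hf).add (Pg hg)
  -- Compact operators are norm-closed, and the superposition is 1-Lipschitz in the `L¹`
  -- coefficient.
  · have : IsClosed {f : Z →₁[m] ℂ | IsCompactOperator
        (superposition hδ (L1.integrable_coeFn f))} :=
      isClosed_setOfPred_isCompactOperator.preimage (continuous_superposition hδ)
    convert! this using 1
    ext f
    exact ⟨fun h => h _, fun h _ => h⟩
  · intro f g hfg hf Pf hg
    rw [superposition_congr hδ hg hf hfg.symm]
    exact Pf hf

end Superposition

/-! ### Superpositions given by square-integrable kernels -/

section HilbertSchmidt

variable {Z : Type*} [MeasurableSpace Z] {m : Measure Z} {δ : Z → Plane} {c : Z → ℂ}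

theorem measurable_weylPhase_uncurry : Measurable fun p : Plane × ℝ => weylPhase p.1 p.2 := by
  have : Continuous fun p : Plane × ℝ => weylPhase p.1 p.2 := by unfold weylPhase; fun_prop
  exact this.measurable

theorem measurePreserving_shear [SFinite m] (hδ : Measurable δ) :
    MeasurePreserving (fun p : Z × ℝ => (p.1, p.2 + δ p.1 0)) (m.prod volume) (m.prod volume) := by
  have h0 : Measurable fun z => δ z 0 := by fun_prop
  refine (MeasurePreserving.id m).skew_product (g := fun z t => t + δ z 0)
    (measurable_snd.add (h0.comp measurable_fst)) (Eventually.of_forall fun z => ?_)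
  exact map_add_right_eq_self _ _

/-- The pointwise expression for `(∫ c(z) ρ(δ(z)) dm(z) φ)(t)`. -/
noncomputable def superpositionFun (m : Measure Z) (δ : Z → Plane) (c : Z → ℂ) (φ : ℝ → ℂ)
    (t : ℝ) : ℂ := ∫ z, c z * (weylPhase (δ z) t * φ (t + δ z 0)) ∂m

theorem aestronglyMeasurable_superposition_kernel [SFinite m] (hδ : Measurable δ)
    (hc : Integrable c m) (φ : L2R) :
    AEStronglyMeasurable (fun p : Z × ℝ => c p.1 * (weylPhase (δ p.1) p.2 * φ (p.2 + δ p.1 0)))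
      (m.prod volume) := by
  have h0 : Measurable fun z => δ z 0 := by fun_prop
  refine hc.aestronglyMeasurable.comp_fst.mul (StronglyMeasurable.aestronglyMeasurable ?_)
  refine StronglyMeasurable.mul ?_ ?_
  · exact (measurable_weylPhase_uncurry.comp
      ((hδ.comp measurable_fst).prodMk measurable_snd)).stronglyMeasurable
  · exact (Lp.stronglyMeasurable φ).comp_measurable
      (measurable_snd.add (h0.comp measurable_fst))

/-- The integrand is dominated by `|c| (|χ(t)|² + |φ(t + x)|²)`, and the measure-preserving shear
removes the translation from the second term. This licenses Fubini in `inner_superposition`. -/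
theorem integrable_superposition_kernel [SFinite m] (hδ : Measurable δ)
    (hc : Integrable c m) (φ χ : L2R) :
    Integrable (fun p : Z × ℝ => starRingEnd ℂ (χ p.2) *
      (c p.1 * (weylPhase (δ p.1) p.2 * φ (p.2 + δ p.1 0)))) (m.prod volume) := by
  have hsq : ∀ f : L2R, Integrable (fun t => ‖f t‖ ^ 2) volume := fun f =>
    (memLp_two_iff_integrable_sq_norm (Lp.aestronglyMeasurable f)).1 (Lp.memLp f)
  have h1 : Integrable (fun p : Z × ℝ => ‖c p.1‖ * ‖χ p.2‖ ^ 2) (m.prod volume) :=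
    hc.norm.mul_prod (hsq χ)
  have h2 : Integrable (fun p : Z × ℝ => ‖c p.1‖ * ‖φ (p.2 + δ p.1 0)‖ ^ 2) (m.prod volume) :=
    ((measurePreserving_shear hδ).integrable_comp
      (hc.norm.mul_prod (hsq φ)).aestronglyMeasurable).2 (hc.norm.mul_prod (hsq φ))
  refine (h1.add h2).mono' (AEStronglyMeasurable.mul ?_
    (aestronglyMeasurable_superposition_kernel hδ hc φ)) (Eventually.of_forall fun p => ?_)
  · exact (((Lp.stronglyMeasurable χ).comp_measurable measurable_snd).star).aestronglyMeasurable
  · simp only [norm_mul, norm_weylPhase, one_mul, RCLike.norm_conj, Pi.add_apply]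
    have := norm_nonneg (c p.1)
    nlinarith [mul_nonneg this (sq_nonneg (‖χ p.2‖ - ‖φ (p.2 + δ p.1 0)‖)),
      mul_nonneg this (sq_nonneg (‖χ p.2‖)), mul_nonneg this (sq_nonneg ‖φ (p.2 + δ p.1 0)‖)]

theorem inner_superposition [SFinite m] (hδ : Measurable δ) (hc : Integrable c m) (φ χ : L2R) :
    inner ℂ χ (superposition hδ hc φ)
      = ∫ t, starRingEnd ℂ (χ t) * superpositionFun m δ c φ t := by
  rw [superposition_apply, ← integral_inner (integrable_smul_schrodinger hδ hc φ)]
  have h : ∀ z, inner ℂ χ (c z • schrodinger (δ z) φ)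
      = ∫ t, starRingEnd ℂ (χ t) * (c z * (weylPhase (δ z) t * φ (t + δ z 0))) := by
    intro z
    rw [inner_smul_right, L2.inner_def, ← integral_const_mul]
    refine integral_congr_ae ?_
    filter_upwards [coeFn_schrodinger (δ z) φ] with t ht
    rw [ht, RCLike.inner_apply]
    ring
  simp only [h]
  rw [integral_integral_swap (integrable_superposition_kernel hδ hc φ χ)]
  simp only [superpositionFun, integral_const_mul]

theorem aestronglyMeasurable_superpositionFun [SFinite m] (hδ : Measurable δ)
    (hc : Integrable c m) (φ : L2R) :
    AEStronglyMeasurable (superpositionFun m δ c φ) volume :=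
  (aestronglyMeasurable_superposition_kernel hδ hc φ).prod_swap.integral_prod_right'

theorem enorm_sq_eq_lintegral (f : L2R) : ‖f‖ₑ ^ 2 = ∫⁻ t, ‖f t‖ₑ ^ 2 := by
  rw [Lp.enorm_def, eLpNorm_eq_lintegral_rpow_enorm_toReal (by norm_num) (by norm_num)]
  simp only [ENNReal.toReal_ofNat, ENNReal.rpow_ofNat]
  rw [← ENNReal.rpow_natCast, ← ENNReal.rpow_mul]
  norm_num

/-- Duality: the vector is paired with itself, Cauchy–Schwarz is applied, and one factor of its norm
is cancelled. The Bochner integral in `L²` thus never has to be identified pointwise with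
`superpositionFun`. -/
theorem enorm_superposition_sq_le [SFinite m] (hδ : Measurable δ) (hc : Integrable c m)
    (φ : L2R) :
    ‖superposition hδ hc φ‖ₑ ^ 2 ≤ ∫⁻ t, ‖superpositionFun m δ c φ t‖ₑ ^ 2 := by
  set χ := superposition hδ hc φ with hχ
  set I := ∫⁻ t, ‖superpositionFun m δ c φ t‖ₑ ^ 2
  have h1 : ‖χ‖ₑ ^ 2 ≤ ‖χ‖ₑ * I ^ (1 / 2 : ℝ) := by
    calc ‖χ‖ₑ ^ 2 = ‖inner ℂ χ χ‖ₑ := by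
          rw [inner_self_eq_norm_sq_to_K, ← ofReal_norm, ← ofReal_norm, norm_pow,
            ENNReal.ofReal_pow (norm_nonneg _)]
          simp
      _ = ‖∫ t, starRingEnd ℂ (χ t) * superpositionFun m δ c φ t‖ₑ := by
          conv_lhs => rw [hχ]
          rw [inner_superposition]
      _ ≤ ∫⁻ t, ‖χ t‖ₑ * ‖superpositionFun m δ c φ t‖ₑ := by
          refine (enorm_integral_le_lintegral_enorm _).trans (le_of_eq ?_)
          simp only [enorm_mul, RCLike.enorm_conj]
      _ ≤ (∫⁻ t, ‖χ t‖ₑ ^ (2 : ℝ)) ^ (1 / 2 : ℝ) *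
          (∫⁻ t, ‖superpositionFun m δ c φ t‖ₑ ^ (2 : ℝ)) ^ (1 / 2 : ℝ) :=
          ENNReal.lintegral_mul_le_Lp_mul_Lq _ (Real.HolderConjugate.two_two)
            (Lp.aestronglyMeasurable χ).enorm
            (aestronglyMeasurable_superpositionFun hδ hc φ).enorm
      _ = ‖χ‖ₑ * I ^ (1 / 2 : ℝ) := by
          simp only [ENNReal.rpow_ofNat]
          rw [← enorm_sq_eq_lintegral, ← ENNReal.rpow_natCast, ← ENNReal.rpow_mul]
          norm_num
          rfl
  have h2 : ‖χ‖ₑ ≤ I ^ (1 / 2 : ℝ) := by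
    by_cases h0 : ‖χ‖ₑ = 0
    · rw [h0]; exact zero_le
    · rw [sq] at h1
      exact (ENNReal.mul_le_mul_iff_right h0 enorm_ne_top).1 h1
  calc ‖χ‖ₑ ^ 2 ≤ (I ^ (1 / 2 : ℝ)) ^ 2 := by gcongr
    _ = I := by
      rw [← ENNReal.rpow_natCast, ← ENNReal.rpow_mul]
      norm_num

/-- An operator `∫ c(z) ρ(δ(z)) dm(z)` with a square-integrable kernel is compact. -/
theorem isCompactOperator_superposition_of_kernel [SFinite m] (hδ : Measurable δ)
    (hc : Integrable c m) (K : ℝ → L2R) (hK : ∫⁻ t, ‖K t‖ₑ ^ 2 ≠ ⊤)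
    (h : ∀ (φ : L2R) t, superpositionFun m δ c φ t = inner ℂ (K t) φ) :
    IsCompactOperator (superposition hδ hc) := by
  obtain ⟨w, b, -⟩ := exists_hilbertBasis ℂ L2R
  refine isCompactOperator_of_sum_norm_sq_le b _ (∫⁻ t, ‖K t‖ₑ ^ 2).toReal fun s => ?_
  have h1 : ∑ i ∈ s, ‖superposition hδ hc (b i)‖ₑ ^ 2 ≤ ∫⁻ t, ‖K t‖ₑ ^ 2 := by
    calc ∑ i ∈ s, ‖superposition hδ hc (b i)‖ₑ ^ 2
        ≤ ∑ i ∈ s, ∫⁻ t, ‖superpositionFun m δ c (b i) t‖ₑ ^ 2 :=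
          Finset.sum_le_sum fun i _ => enorm_superposition_sq_le hδ hc _
      _ = ∫⁻ t, ∑ i ∈ s, ‖superpositionFun m δ c (b i) t‖ₑ ^ 2 :=
          (lintegral_finsetSum' _ fun i _ =>
            (aestronglyMeasurable_superpositionFun hδ hc _).enorm.pow_const _).symm
      -- Bessel's inequality for `K t`, separately for each `t`.
      _ ≤ ∫⁻ t, ‖K t‖ₑ ^ 2 := by
          refine lintegral_mono fun t => ?_
          simp only [h, ← ofReal_norm, ← ENNReal.ofReal_pow (norm_nonneg _)]
          rw [← ENNReal.ofReal_sum_of_nonneg fun i _ => sq_nonneg _]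
          refine ENNReal.ofReal_le_ofReal ?_
          refine le_trans (le_of_eq ?_) (b.orthonormal.sum_inner_products_le (K t) (s := s))
          simp only [norm_inner_symm (K t)]
  have h2 := ENNReal.toReal_mono hK h1
  rw [ENNReal.toReal_sum fun i _ => by finiteness] at h2
  simpa using h2

end HilbertSchmidt

/-! ### Rectangles give Hilbert–Schmidt operators -/

section Rectangle

/-- The point of the plane with coordinates `z`. -/
noncomputable def toPlane (z : ℝ × ℝ) : Plane := !₂[z.1, z.2]

theorem measurePreserving_toPlane : MeasurePreserving toPlane :=
  (PiLp.volume_preserving_toLp (Fin 2)).comp (volume_preserving_finTwoArrow ℝ).symm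

theorem measurable_toPlane : Measurable toPlane := measurePreserving_toPlane.measurable

/-- The integral `∫_c^d e^{πiyw} dy`. -/
noncomputable def phaseIntegral (c d w : ℝ) : ℂ :=
  ∫ y in Set.Ioc c d, Complex.exp ((Real.pi * w * y : ℝ) * Complex.I)

theorem continuous_phaseIntegral (c d : ℝ) : Continuous (phaseIntegral c d) := by
  refine continuous_of_dominated (bound := fun _ => 1) (fun w => ?_) (fun w => ?_)
    (integrable_const 1) ?_
  · have : Continuous fun y : ℝ => Complex.exp ((Real.pi * w * y : ℝ) * Complex.I) := by fun_prop
    exact this.aestronglyMeasurable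
  · exact Eventually.of_forall fun y => (Complex.norm_exp_ofReal_mul_I _).le
  · exact Eventually.of_forall fun y => by fun_prop

/-- Two bounds are added after squaring: the trivial one `d - c`, and `2 / (π |w|) ≤ 1 / |w|` from
the explicit antiderivative. -/
theorem norm_phaseIntegral_sq_le {c d : ℝ} (hcd : c ≤ d) (w : ℝ) :
    ‖phaseIntegral c d w‖ ^ 2 ≤ ((d - c) ^ 2 + 1) * (1 + w ^ 2)⁻¹ := by
  have h1 : ‖phaseIntegral c d w‖ ≤ d - c := by
    have := norm_setIntegral_le_of_norm_le_const (μ := volume) (s := Set.Ioc c d) (C := 1)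
      (f := fun y : ℝ => Complex.exp ((Real.pi * w * y : ℝ) * Complex.I)) (by simp)
      (fun y _ => (Complex.norm_exp_ofReal_mul_I _).le)
    simpa [hcd, phaseIntegral] using this
  have h2 : ‖phaseIntegral c d w‖ * |w| ≤ 1 := by
    rcases eq_or_ne w 0 with rfl | hw
    · simp
    have hpi := Real.pi_pos
    have e : phaseIntegral c d w =
        (Complex.exp ((Real.pi * w * d : ℝ) * Complex.I)
          - Complex.exp ((Real.pi * w * c : ℝ) * Complex.I)) / ((Real.pi * w : ℝ) * Complex.I) := by
      have hne : ((Real.pi * w : ℝ) : ℂ) * Complex.I ≠ 0 := by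
        simp [hw, hpi.ne']
      have := integral_exp_mul_complex (a := c) (b := d) hne
      rw [intervalIntegral.integral_of_le hcd] at this
      have hexp : ∀ y : ℝ, ((Real.pi * w * y : ℝ) : ℂ) * Complex.I
          = ((Real.pi * w : ℝ) : ℂ) * Complex.I * y := fun y => by push_cast; ring
      simp only [phaseIntegral, hexp]
      exact this
    rw [e, norm_div, norm_mul, Complex.norm_I, mul_one, Complex.norm_real, norm_mul,
      Real.norm_eq_abs, Real.norm_eq_abs, abs_of_pos hpi]
    have h3 : ‖Complex.exp ((Real.pi * w * d : ℝ) * Complex.I)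
          - Complex.exp ((Real.pi * w * c : ℝ) * Complex.I)‖ ≤ 2 := by
      refine (norm_sub_le _ _).trans ?_
      rw [Complex.norm_exp_ofReal_mul_I, Complex.norm_exp_ofReal_mul_I]
      norm_num
    have hw' : 0 < |w| := abs_pos.2 hw
    rw [div_mul_eq_mul_div, div_le_one (by positivity)]
    nlinarith [Real.pi_gt_three]
  rw [← div_eq_mul_inv, le_div_iff₀ (by positivity), mul_add, mul_one]
  have h4 : (‖phaseIntegral c d w‖ * |w|) ^ 2 ≤ 1 :=
    pow_le_one₀ (by positivity) h2
  rw [mul_pow, sq_abs] at h4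
  have h5 : ‖phaseIntegral c d w‖ ^ 2 ≤ (d - c) ^ 2 := by gcongr
  linarith

theorem lintegral_phaseIntegral_sq_le {c d : ℝ} (hcd : c ≤ d) :
    ∃ A : ℝ≥0∞, A ≠ ⊤ ∧ ∀ x : ℝ, ∫⁻ t, ‖phaseIntegral c d (x + 2 * t)‖ₑ ^ 2 ≤ A := by
  let g : ℝ → ℝ≥0∞ := fun t => ENNReal.ofReal (((d - c) ^ 2 + 1) * (1 + t ^ 2)⁻¹)
  have hg : ∫⁻ t, g t ≠ ⊤ := by
    have h := (integrable_inv_one_add_sq.const_mul ((d - c) ^ 2 + 1)).lintegral_lt_top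
    exact h.ne
  refine ⟨∫⁻ t, g t, hg, fun x => ?_⟩
  -- Since `(x + 2t)² = 4 (t + x/2)² ≥ (t + x/2)²`, a translate of `g` dominates, and its integral
  -- does not depend on `x`.
  rw [← lintegral_add_right_eq_self g (x / 2)]
  refine lintegral_mono fun t => ?_
  rw [← ofReal_norm, ← ENNReal.ofReal_pow (norm_nonneg _)]
  refine ENNReal.ofReal_le_ofReal ((norm_phaseIntegral_sq_le hcd _).trans ?_)
  refine mul_le_mul_of_nonneg_left (inv_anti₀ (by positivity) ?_) (by positivity)
  nlinarith [sq_nonneg (t + x / 2)]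

/-- The kernel of the Weyl transform of the indicator of a rectangle, up to conjugation. -/
noncomputable def rectangleKernel (a b c d t u : ℝ) : ℂ :=
  (Set.Ioc a b).indicator (fun _ => starRingEnd ℂ (phaseIntegral c d (u + t))) (u - t)

theorem measurable_rectangleKernel (a b c d : ℝ) :
    Measurable fun p : ℝ × ℝ => rectangleKernel a b c d p.1 p.2 := by
  have h1 : Measurable fun p : ℝ × ℝ => starRingEnd ℂ (phaseIntegral c d (p.2 + p.1)) := by
    have := continuous_phaseIntegral c d
    have h : Continuous fun p : ℝ × ℝ => starRingEnd ℂ (phaseIntegral c d (p.2 + p.1)) := by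
      fun_prop
    exact h.measurable
  have h2 : MeasurableSet {p : ℝ × ℝ | p.2 - p.1 ∈ Set.Ioc a b} :=
    (measurable_snd.sub measurable_fst) measurableSet_Ioc
  exact h1.indicator h2

/-- With `u = t + x` and Tonelli, each `x` in the bounded interval contributes at most the uniform
constant `A`. -/
theorem lintegral_rectangleKernel_ne_top {a b c d : ℝ} (hcd : c ≤ d) :
    ∫⁻ t, ∫⁻ u, ‖rectangleKernel a b c d t u‖ₑ ^ 2 ≠ ⊤ := by
  obtain ⟨A, hA, h⟩ := lintegral_phaseIntegral_sq_le hcd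
  let f : ℝ → ℝ → ℝ≥0∞ := fun t x => (Set.Ioc a b).indicator
    (fun _ => ‖phaseIntegral c d (x + 2 * t)‖ₑ ^ 2) x
  have e : ∀ t, ∫⁻ u, ‖rectangleKernel a b c d t u‖ₑ ^ 2 = ∫⁻ x, f t x := by
    intro t
    rw [← lintegral_add_right_eq_self _ t]
    refine lintegral_congr fun x => ?_
    simp only [rectangleKernel, f, add_sub_cancel_right]
    by_cases hx : x ∈ Set.Ioc a b
    · simp only [Set.indicator_of_mem hx, RCLike.enorm_conj]
      congr 3; ring
    · simp [Set.indicator_of_notMem hx]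
  have hf : Measurable (Function.uncurry f) := by
    have h1 : Measurable fun p : ℝ × ℝ => ‖phaseIntegral c d (p.2 + 2 * p.1)‖ₑ ^ 2 := by
      have := continuous_phaseIntegral c d
      have h : Continuous fun p : ℝ × ℝ => phaseIntegral c d (p.2 + 2 * p.1) := by fun_prop
      exact h.measurable.enorm.pow_const _
    exact h1.indicator (measurable_snd measurableSet_Ioc)
  simp only [e]
  rw [lintegral_lintegral_swap hf.aemeasurable]
  have h3 : ∀ x, ∫⁻ t, f t x ≤ (Set.Ioc a b).indicator (fun _ => A) x := by
    intro x
    by_cases hx : x ∈ Set.Ioc a b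
    · simpa only [f, Set.indicator_of_mem hx] using h x
    · simp [f, Set.indicator_of_notMem hx]
  refine ((lintegral_mono h3).trans_lt ?_).ne
  rw [lintegral_indicator measurableSet_Ioc, setLIntegral_const]
  exact ENNReal.mul_lt_top hA.lt_top (by simp)

theorem memLp_rectangleKernel {a b c d : ℝ} (hcd : c ≤ d) (t : ℝ) :
    MemLp (rectangleKernel a b c d t) 2 volume := by
  have hm : Measurable (rectangleKernel a b c d t) :=
    (measurable_rectangleKernel a b c d).comp measurable_prodMk_left
  have hi : Integrable ((Set.Ioc (t + a) (t + b)).indicator fun _ : ℝ => (d - c) ^ 2 + 1) :=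
    (integrable_indicator_iff measurableSet_Ioc).2 (integrableOn_const (by simp))
  refine (memLp_two_iff_integrable_sq_norm hm.aestronglyMeasurable).2
    (hi.mono' (by fun_prop) (Eventually.of_forall fun u => ?_))
  rw [Real.norm_of_nonneg (sq_nonneg _)]
  by_cases hu : u - t ∈ Set.Ioc a b
  · rw [rectangleKernel, Set.indicator_of_mem hu, Set.indicator_of_mem
      (Set.mem_Ioc.2 ⟨by linarith [hu.1], by linarith [hu.2]⟩), RCLike.norm_conj]
    refine (norm_phaseIntegral_sq_le hcd _).trans (mul_le_of_le_one_right (by positivity) ?_)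
    exact inv_le_one_of_one_le₀ (by nlinarith [sq_nonneg (u + t)])
  · rw [rectangleKernel, Set.indicator_of_notMem hu, norm_zero]
    simpa using Set.indicator_nonneg (fun _ _ => by positivity) u

/-- The substitution `u = t + x` turns the phase `xy + 2yt` into `y (u + t)`, so the `y`-integral is
`phaseIntegral` at `u + t`. The kernel carries a conjugate because the inner product is
conjugate-linear in its first slot. -/
theorem superpositionFun_rectangle (a b c d : ℝ) (φ : L2R) (t : ℝ) :
    superpositionFun volume toPlane ((Set.Ioc a b ×ˢ Set.Ioc c d).indicator fun _ => (1 : ℂ)) φ t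
      = ∫ u, starRingEnd ℂ (rectangleKernel a b c d t u) * φ u := by
  have h1 : Integrable (fun x => (Set.Ioc a b).indicator (fun x => φ (t + x)) x) volume := by
    rw [integrable_indicator_iff measurableSet_Ioc]
    have h : MemLp (fun x => φ (t + x)) 2 volume :=
      (Lp.memLp φ).comp_measurePreserving (measurePreserving_add_left volume t)
    exact (h.restrict _).integrable (by norm_num)
  have h2 : Integrable ((Set.Ioc c d).indicator fun _ => (1 : ℂ)) volume :=
    (integrable_indicator_iff measurableSet_Ioc).2 (integrableOn_const (by simp))
  have h3 : Integrable (fun z : ℝ × ℝ => weylPhase (toPlane z) t *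
      ((Set.Ioc a b).indicator (fun x => φ (t + x)) z.1 *
        (Set.Ioc c d).indicator (fun _ => (1 : ℂ)) z.2)) (volume.prod volume) := by
    refine (h1.mul_prod h2).bdd_mul (c := 1) ?_ (Eventually.of_forall fun z => ?_)
    · exact ((continuous_weylPhase_left t).measurable.comp
        measurable_toPlane).aestronglyMeasurable
    · rw [norm_weylPhase]
  have e1 : superpositionFun volume toPlane
      ((Set.Ioc a b ×ˢ Set.Ioc c d).indicator fun _ => (1 : ℂ)) φ t =
      ∫ z : ℝ × ℝ, weylPhase (toPlane z) t *
        ((Set.Ioc a b).indicator (fun x => φ (t + x)) z.1 *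
          (Set.Ioc c d).indicator (fun _ => (1 : ℂ)) z.2) ∂(volume.prod volume) := by
    refine integral_congr_ae (Eventually.of_forall fun z => ?_)
    by_cases hx : z.1 ∈ Set.Ioc a b <;> by_cases hy : z.2 ∈ Set.Ioc c d <;>
      simp [Set.indicator, hx, hy, toPlane]
  rw [e1, integral_prod _ h3]
  refine Eq.trans ?_ (integral_add_right_eq_self
    (fun u => starRingEnd ℂ (rectangleKernel a b c d t u) * φ u) t)
  refine integral_congr_ae (Eventually.of_forall fun x => ?_)
  simp only [rectangleKernel, add_sub_cancel_right]
  by_cases hx : x ∈ Set.Ioc a b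
  · simp only [Set.indicator_of_mem hx, RingHomCompTriple.comp_apply, RingHom.id_apply]
    rw [phaseIntegral, ← integral_indicator measurableSet_Ioc, ← integral_mul_const]
    refine integral_congr_ae (Eventually.of_forall fun y => ?_)
    by_cases hy : y ∈ Set.Ioc c d
    · simp only [Set.indicator_of_mem hy, weylPhase, toPlane, mul_one]
      congr 1
      · congr 3
        simp
        ring
      · rw [add_comm]
    · simp [Set.indicator_of_notMem hy]
  · simp [Set.indicator_of_notMem hx]

theorem isCompactOperator_superposition_rectangle (a b c d : ℝ)
    (h : Integrable ((Set.Ioc a b ×ˢ Set.Ioc c d).indicator fun _ => (1 : ℂ)) volume) :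
    IsCompactOperator (superposition measurable_toPlane h) := by
  rcases lt_or_ge d c with hdc | hcd
  · have : superposition measurable_toPlane h = 0 := by
      ext1 φ
      simp [superposition_apply, Set.Ioc_eq_empty hdc.not_gt]
    rw [this]
    exact isCompactOperator_zero
  · have hk := fun t => (memLp_rectangleKernel (a := a) (b := b) hcd t).coeFn_toLp
    refine isCompactOperator_superposition_of_kernel measurable_toPlane h
      (fun t => (memLp_rectangleKernel (a := a) (b := b) hcd t).toLp) ?_ fun φ t => ?_
    · simp only [enorm_sq_eq_lintegral]
      have : ∀ t, ∫⁻ u, ‖(memLp_rectangleKernel (a := a) (b := b) hcd t).toLp _ u‖ₑ ^ 2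
          = ∫⁻ u, ‖rectangleKernel a b c d t u‖ₑ ^ 2 := fun t => by
        refine lintegral_congr_ae ?_
        filter_upwards [hk t] with u hu
        rw [hu]
      simp only [this]
      exact lintegral_rectangleKernel_ne_top hcd
    · rw [superpositionFun_rectangle, L2.inner_def]
      refine integral_congr_ae ?_
      filter_upwards [hk t] with u hu
      rw [hu, RCLike.inner_apply, mul_comm]

end Rectangle

/-! ### From rectangles to integrable densities -/

section AbsolutelyContinuous

variable {Z : Type*} [MeasurableSpace Z] {m : Measure Z} {δ : Z → Plane} {c : Z → ℂ}

theorem isCompactOperator_superposition_of_dominated (hδ : Measurable δ) (hc : Integrable c m)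
    {F : ℕ → Z → ℂ} (hF : ∀ n, Integrable (F n) m)
    (hcomp : ∀ n, IsCompactOperator (superposition hδ (hF n)))
    {bound : Z → ℝ} (hbound : Integrable bound m) (hle : ∀ n z, ‖F n z‖ ≤ bound z)
    (hlim : ∀ z, Tendsto (fun n => F n z) atTop (𝓝 (c z))) :
    IsCompactOperator (superposition hδ hc) := by
  refine isCompactOperator_of_tendsto (l := atTop) (F := fun n => superposition hδ (hF n)) ?_
    (Eventually.of_forall hcomp)
  rw [tendsto_iff_norm_sub_tendsto_zero]
  have h : Tendsto (fun n => ∫ z, ‖F n z - c z‖ ∂m) atTop (𝓝 (∫ _, 0 ∂m)) := by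
    refine tendsto_integral_of_dominated_convergence (fun z => bound z + ‖c z‖)
      (fun n => ((hF n).sub hc).norm.aestronglyMeasurable) (hbound.add hc.norm)
      (fun n => Eventually.of_forall fun z => ?_) (Eventually.of_forall fun z => ?_)
    · rw [norm_norm]
      exact (norm_sub_le _ _).trans (by gcongr; exact hle n z)
    · exact tendsto_iff_norm_sub_tendsto_zero.1 (hlim z)
  rw [integral_zero] at h
  exact squeeze_zero (fun _ => norm_nonneg _) (fun n => norm_superposition_sub_le hδ _ _) h

theorem isCompactOperator_superposition_indicator_of_monotone (hδ : Measurable δ)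
    {E : ℕ → Set Z} (hE : Monotone E)
    (hF : ∀ n, Integrable ((E n).indicator fun _ => (1 : ℂ)) m)
    (hcomp : ∀ n, IsCompactOperator (superposition hδ (hF n)))
    (h : Integrable ((⋃ n, E n).indicator fun _ => (1 : ℂ)) m) :
    IsCompactOperator (superposition hδ h) := by
  refine isCompactOperator_superposition_of_dominated hδ h hF hcomp h.norm (fun n z => ?_)
    (fun z => ?_)
  · exact norm_indicator_le_of_subset (Set.subset_iUnion E n) _ _
  · exact (hE.tendsto_indicator E (fun _ => (1 : ℂ)) z).mono_right (pure_le_nhds _)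

theorem iUnion_Iic_natCast : ⋃ k : ℕ, Set.Iic (k : ℝ) = Set.univ :=
  Set.iUnion_eq_univ_iff.2 fun x => exists_nat_ge x

/-- Dynkin's π-λ argument on the quadrants `Iic x ×ˢ Iic y`, cut down to a fixed box to keep all
measures finite. Half-open boxes are used because a quadrant meets one in another half-open
rectangle. -/
theorem isCompactOperator_superposition_indicator_inter_rectangle (n : ℕ) {E : Set (ℝ × ℝ)}
    (hE : MeasurableSet E)
    (h : Integrable ((E ∩ (Set.Ioc (-n : ℝ) n ×ˢ Set.Ioc (-n : ℝ) n)).indicator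
      fun _ => (1 : ℂ)) volume) :
    IsCompactOperator (superposition measurable_toPlane h) := by
  set B : Set (ℝ × ℝ) := Set.Ioc (-n : ℝ) n ×ˢ Set.Ioc (-n : ℝ) n with hB
  have hBm : MeasurableSet B := measurableSet_Ioc.prod measurableSet_Ioc
  have hBfin : volume B ≠ ⊤ := by
    rw [hB, Measure.volume_eq_prod, Measure.prod_prod]
    simp [ENNReal.mul_eq_top]
  have hint : ∀ s : Set (ℝ × ℝ), MeasurableSet s →
      Integrable ((s ∩ B).indicator fun _ => (1 : ℂ)) volume := fun s hs =>
    (integrable_indicator_iff (hs.inter hBm)).2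
      (integrableOn_const (measure_ne_top_of_subset Set.inter_subset_right hBfin))
  have hgen : (inferInstance : MeasurableSpace (ℝ × ℝ)) = MeasurableSpace.generateFrom
      (Set.image2 (· ×ˢ ·) (Set.range (Set.Iic : ℝ → Set ℝ)) (Set.range Set.Iic)) := by
    refine (generateFrom_eq_prod ?_ ?_ ?_ ?_).symm
    · rw [← borel_eq_generateFrom_Iic]; exact (BorelSpace.measurable_eq).symm
    · rw [← borel_eq_generateFrom_Iic]; exact (BorelSpace.measurable_eq).symm
    · exact ⟨fun k : ℕ => Set.Iic (k : ℝ), fun k => ⟨_, rfl⟩, iUnion_Iic_natCast⟩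
    · exact ⟨fun k : ℕ => Set.Iic (k : ℝ), fun k => ⟨_, rfl⟩, iUnion_Iic_natCast⟩
  induction E, hE using MeasurableSpace.induction_on_inter hgen
    (isPiSystem_Iic.prod isPiSystem_Iic) with
  | empty =>
    have : superposition measurable_toPlane h = 0 := by
      ext1 φ
      simp [superposition_apply]
    rw [this]
    exact isCompactOperator_zero
  | basic t ht =>
    obtain ⟨_, ⟨x, rfl⟩, _, ⟨y, rfl⟩, rfl⟩ := ht
    have e : (Set.Iic x ×ˢ Set.Iic y) ∩ B
        = Set.Ioc (-n : ℝ) (min n x) ×ˢ Set.Ioc (-n : ℝ) (min n y) := by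
      rw [hB, Set.prod_inter_prod, Set.inter_comm, Set.Ioc_inter_Iic, Set.inter_comm,
        Set.Ioc_inter_Iic]
    have h' := h
    simp only [e] at h'
    rw [superposition_congr _ h h' (by simp only [e]; exact ae_eq_refl _)]
    exact isCompactOperator_superposition_rectangle _ _ _ _ h'
  | compl t ht ih =>
    have hB1 : Integrable (B.indicator fun _ => (1 : ℂ)) volume := by
      simpa using hint Set.univ MeasurableSet.univ
    -- The complement within the box is the box minus the set, and compact operators form a vector
    -- space.
    have hadd : superposition measurable_toPlane hB1
        = superposition measurable_toPlane h + superposition measurable_toPlane (hint t ht) := by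
      rw [← superposition_add]
      refine superposition_congr _ _ _ (Eventually.of_forall fun z => ?_)
      by_cases hz : z ∈ t <;> by_cases hz' : z ∈ B <;> simp [Set.indicator, hz, hz']
    rw [eq_sub_of_add_eq hadd.symm]
    exact (isCompactOperator_superposition_rectangle _ _ _ _ hB1).sub (ih (hint t ht) (hint t ht))
  | iUnion f hd hf ih =>
    -- Finite disjoint unions are handled by addition, the countable union as their increasing
    -- limit.
    have hpart : ∀ k, MeasurableSet (⋃ i < k, f i) := fun k =>
      MeasurableSet.biUnion (Set.to_countable _) fun i _ => hf i
    have hP : ∀ k, ∀ hk : Integrable (((⋃ i < k, f i) ∩ B).indicator fun _ => (1 : ℂ)) volume,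
        IsCompactOperator (superposition measurable_toPlane hk) := by
      intro k
      induction k with
      | zero =>
        intro hk
        have : superposition measurable_toPlane hk = 0 := by
          ext1 φ
          simp [superposition_apply]
        rw [this]
        exact isCompactOperator_zero
      | succ k ihk =>
        intro hk
        have : superposition measurable_toPlane hk
            = superposition measurable_toPlane (hint _ (hpart k))
              + superposition measurable_toPlane (hint _ (hf k)) := by
          rw [← superposition_add]
          refine superposition_congr _ _ _ (Eventually.of_forall fun z => ?_)
          have hdisj : Disjoint ((⋃ i < k, f i) ∩ B) (f k ∩ B) := by
            refine Disjoint.mono Set.inter_subset_left Set.inter_subset_left ?_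
            simp only [Set.disjoint_iUnion_left]
            exact fun i hi => hd hi.ne
          have hun : (⋃ i < k + 1, f i) ∩ B = ((⋃ i < k, f i) ∩ B) ∪ (f k ∩ B) := by
            rw [Set.biUnion_lt_succ, Set.union_inter_distrib_right]
          simp only [hun]
          exact congrFun (Set.indicator_union_of_disjoint hdisj _) z
        rw [this]
        exact (ihk _).add (ih k (hint _ (hf k)) (hint _ (hf k)))
    have hU : (⋃ i, f i) ∩ B = ⋃ k, (⋃ i < k, f i) ∩ B := by
      rw [← Set.iUnion_inter]
      congr 1
      ext z
      simp only [Set.mem_iUnion]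
      exact ⟨fun ⟨i, hi⟩ => ⟨i + 1, i, Nat.lt_succ_self i, hi⟩, fun ⟨_, i, _, hi⟩ => ⟨i, hi⟩⟩
    have h' := h
    simp only [hU] at h'
    rw [superposition_congr _ h h' (by simp only [hU]; exact ae_eq_refl _)]
    refine isCompactOperator_superposition_indicator_of_monotone _ ?_
      (fun k => hint _ (hpart k)) (fun k => hP k _) h'
    intro k l hkl
    exact Set.inter_subset_inter_left _ (Set.biUnion_subset_biUnion_left
      fun i (hi : i < k) => hi.trans_le hkl)

/-- The Weyl transform of an integrable function on the plane is compact. -/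
theorem isCompactOperator_superposition_toPlane {F : ℝ × ℝ → ℂ} (hF : Integrable F volume) :
    IsCompactOperator (superposition measurable_toPlane hF) := by
  refine isCompactOperator_superposition_of_indicator _ (fun E hE hfin hint => ?_) hF
  let B : ℕ → Set (ℝ × ℝ) := fun n => Set.Ioc (-n : ℝ) n ×ˢ Set.Ioc (-n : ℝ) n
  have hB : ∀ n, MeasurableSet (B n) := fun n => measurableSet_Ioc.prod measurableSet_Ioc
  have hU : E = ⋃ n, E ∩ B n := by
    rw [← Set.inter_iUnion, Set.iUnion_eq_univ_iff.2, Set.inter_univ]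
    intro z
    obtain ⟨n, hn⟩ := exists_nat_gt (max |z.1| |z.2|)
    have h1 := abs_lt.1 ((le_max_left _ _).trans_lt hn)
    have h2 := abs_lt.1 ((le_max_right _ _).trans_lt hn)
    exact ⟨n, ⟨h1.1, h1.2.le⟩, ⟨h2.1, h2.2.le⟩⟩
  have hint' := hint
  rw [hU] at hint'
  rw [superposition_congr _ hint hint' (by rw [← hU])]
  refine isCompactOperator_superposition_indicator_of_monotone _ ?_
    (fun n => (integrable_indicator_iff (hE.inter (hB n))).2
      (integrableOn_const (measure_ne_top_of_subset Set.inter_subset_left hfin)))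
    (fun n => isCompactOperator_superposition_indicator_inter_rectangle n hE _) hint'
  intro k l hkl
  have : (k : ℝ) ≤ l := by exact_mod_cast hkl
  refine Set.inter_subset_inter_right _ (Set.prod_mono ?_ ?_) <;>
    exact Set.Ioc_subset_Ioc (by linarith) this

/-- If the image of `m` under `δ` is absolutely continuous, then `∫ c(z) ρ(δ(z)) dm(z)` is
compact. -/
theorem isCompactOperator_superposition_of_absolutelyContinuous [IsFiniteMeasure m]
    (hδ : Measurable δ) (hac : m.map δ ≪ volume) (hc : Integrable c m) :
    IsCompactOperator (superposition hδ hc) := by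
  refine isCompactOperator_superposition_of_indicator _ (fun E hE _ hint => ?_) hc
  -- For an indicator coefficient the superposition is `∫ ρ dη` with `η` a positive measure, so its
  -- Radon–Nikodym density turns it into the Weyl transform of an integrable function.
  set η := (m.restrict E).map δ
  have hη : η ≪ volume := (Measure.map_mono Measure.restrict_le_self hδ).absolutelyContinuous.trans hac
  have hFint : Integrable (fun p => (((η.rnDeriv volume p).toReal : ℝ) : ℂ)) volume :=
    Measure.integrable_toReal_rnDeriv.ofReal
  have hFint' : Integrable (fun z => (((η.rnDeriv volume (toPlane z)).toReal : ℝ) : ℂ)) volume :=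
    (measurePreserving_toPlane.integrable_comp hFint.aestronglyMeasurable).2 hFint
  have e : superposition hδ hint = superposition measurable_toPlane hFint' := by
    ext1 φ
    have hsm := (continuous_schrodinger φ).stronglyMeasurable
    rw [superposition_apply, superposition_apply]
    calc ∫ z, E.indicator (fun _ => (1 : ℂ)) z • schrodinger (δ z) φ ∂m
        = ∫ z in E, schrodinger (δ z) φ ∂m := by
          rw [← integral_indicator hE]
          refine integral_congr_ae (Eventually.of_forall fun z => ?_)
          by_cases hz : z ∈ E <;> simp [hz]
      _ = ∫ p, schrodinger p φ ∂η :=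
          (integral_map hδ.aemeasurable hsm.aestronglyMeasurable).symm
      _ = ∫ p, (η.rnDeriv volume p).toReal • schrodinger p φ :=
          (integral_rnDeriv_smul hη).symm
      _ = ∫ p, (η.rnDeriv volume p).toReal • schrodinger p φ ∂(volume.map toPlane) := by
          rw [measurePreserving_toPlane.map_eq]
      _ = ∫ z, (η.rnDeriv volume (toPlane z)).toReal • schrodinger (toPlane z) φ :=
          integral_map measurable_toPlane.aemeasurable
            ((Measure.measurable_rnDeriv _ _).ennreal_toReal.stronglyMeasurable.smul
              hsm).aestronglyMeasurable
      _ = _ := integral_congr_ae (Eventually.of_forall fun z => (Complex.coe_smul _ _).symm)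
  rw [e]
  exact isCompactOperator_superposition_toPlane hFint'

end AbsolutelyContinuous

/-! ### The operator `T* T` as a twisted convolution -/

section TwistedConvolution

/-- The cocycle with `ρ(p)* ρ(q) = twist p q • ρ(q - p)`. -/
noncomputable def twist (p q : Plane) : ℂ :=
  Complex.exp (((Real.pi * (q 0 * p 1 - p 0 * q 1) : ℝ) : ℂ) * Complex.I)

theorem norm_twist (p q : Plane) : ‖twist p q‖ = 1 := Complex.norm_exp_ofReal_mul_I _

theorem continuous_twist : Continuous fun z : Plane × Plane => twist z.1 z.2 := by
  unfold twist; fun_prop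

theorem conj_weylPhase_mul_weylPhase (p q : Plane) (t : ℝ) :
    starRingEnd ℂ (weylPhase p t) * weylPhase q t = twist p q * weylPhase (q - p) (t + p 0) := by
  simp only [weylPhase, twist]
  rw [← Complex.exp_conj, ← Complex.exp_add, ← Complex.exp_add]
  congr 1
  simp only [map_mul, Complex.conj_ofReal, Complex.conj_I, PiLp.sub_apply]
  push_cast
  ring

/-- Translation by `p 0` moves `χ` back to the origin, and the phases combine by the cocycle
identity. -/
theorem inner_schrodinger_schrodinger (p q : Plane) (φ χ : L2R) :
    inner ℂ (schrodinger p χ) (schrodinger q φ)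
      = twist p q * inner ℂ χ (schrodinger (q - p) φ) := by
  have h : ∀ᵐ t : ℝ, schrodinger (q - p) φ (t + p 0)
      = weylPhase (q - p) (t + p 0) * φ (t + p 0 + (q - p) 0) :=
    (measurePreserving_add_right (volume : Measure ℝ) (p 0)).quasiMeasurePreserving.ae
      (coeFn_schrodinger (q - p) φ)
  rw [L2.inner_def, L2.inner_def, ← integral_const_mul]
  refine Eq.trans ?_ (integral_add_right_eq_self
    (fun t => twist p q * inner ℂ (χ t) (schrodinger (q - p) φ t)) (p 0))
  refine integral_congr_ae ?_
  filter_upwards [h, coeFn_schrodinger p χ, coeFn_schrodinger q φ] with t h1 h2 h3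
  have e : t + p 0 + (q - p) 0 = t + q 0 := by simp
  simp only [h1, h2, h3, RCLike.inner_apply, map_mul, e]
  linear_combination (starRingEnd ℂ (χ (t + p 0)) * φ (t + q 0)) *
    conj_weylPhase_mul_weylPhase p q t

variable {ν : Measure Plane} {ψ : Plane → ℂ}

theorem integrable_twistedProduct [SFinite ν] (hψ : Integrable ψ ν) :
    Integrable (fun z : Plane × Plane => twist z.1 z.2 * (starRingEnd ℂ (ψ z.1) * ψ z.2))
      (ν.prod ν) := by
  refine Integrable.bdd_mul (c := 1) ?_ continuous_twist.aestronglyMeasurable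
    (Eventually.of_forall fun z => (norm_twist _ _).le)
  have hconj : Integrable (fun p => starRingEnd ℂ (ψ p)) ν :=
    hψ.mono hψ.1.star (Eventually.of_forall fun p => (RCLike.norm_conj _).le)
  exact hconj.mul_prod hψ

/-- Both sides are tested against `χ`: `⟪T χ, T φ⟫` expands into a double integral, so no formula
for `T*` itself is required. -/
theorem adjoint_superposition_comp [SFinite ν] (hψ : Integrable ψ ν) :
    ContinuousLinearMap.adjoint (superposition measurable_id hψ) ∘L superposition measurable_id hψ
      = superposition (δ := fun z : Plane × Plane => z.2 - z.1)
        (measurable_snd.sub measurable_fst) (integrable_twistedProduct hψ) := by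
  ext1 φ
  refine ext_inner_left ℂ fun χ => ?_
  rw [ContinuousLinearMap.comp_apply, ContinuousLinearMap.adjoint_inner_right]
  have hi := integrable_smul_schrodinger measurable_id hψ
  have hS := integrable_smul_schrodinger (δ := fun z : Plane × Plane => z.2 - z.1)
    (measurable_snd.sub measurable_fst)
    (integrable_twistedProduct hψ) φ
  rw [superposition_apply _ _ φ, ← integral_inner (hi φ), superposition_apply _ _ φ,
    ← integral_inner hS, integral_prod_symm _ (hS.const_inner χ)]
  refine integral_congr_ae (Eventually.of_forall fun q => ?_)
  simp only
  rw [← inner_conj_symm, superposition_apply, ← integral_inner (hi χ), ← integral_conj]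
  refine integral_congr_ae (Eventually.of_forall fun p => ?_)
  simp only
  rw [inner_conj_symm]
  simp only [inner_smul_left, inner_smul_right, id, inner_schrodinger_schrodinger]
  ring

/-- If the difference of two independent points distributed by `ν` has an absolutely continuous
distribution, then the Weyl transform of every `ψ ν` is compact. -/
theorem isCompactOperator_superposition_id [IsFiniteMeasure ν] (hψ : Integrable ψ ν)
    (hac : (ν.prod ν).map (fun z : Plane × Plane => z.2 - z.1) ≪ volume) :
    IsCompactOperator (superposition measurable_id hψ) := by
  refine isCompactOperator_of_adjoint_comp _ ?_
  rw [adjoint_superposition_comp]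
  exact isCompactOperator_superposition_of_absolutelyContinuous _ hac _

end TwistedConvolution

/-! ### Integration against a complex measure with density -/

section Density

theorem integral_variation_withDensityᵥ {X E : Type*} [MeasurableSpace X] [NormedAddCommGroup E]
    [NormedSpace ℝ E] {m : Measure X} {ψ : X → ℂ} (hψ : Integrable ψ m) (hψm : Measurable ψ)
    (g : X → E) : ∫ x, g x ∂(m.withDensityᵥ ψ).variation = ∫ x, ‖ψ x‖ • g x ∂m := by
  rw [Measure.variation_withDensityᵥ hψ, integral_withDensity_eq_integral_toReal_smul hψm.enorm
    (Eventually.of_forall fun x => enorm_lt_top)]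
  simp only [toReal_enorm]

/-- Polar decomposition: the measure is `u` times its variation, with `u = ψ / ‖ψ‖`, and the
variation has density `‖ψ‖`. The formula is checked on indicators and extended by linearity and `L¹`
continuity. This links the vector-measure definition of the Weyl transform to ordinary Bochner
integrals. -/
theorem integral_withDensityᵥ_lsmul {X E : Type*} [MeasurableSpace X] [NormedAddCommGroup E]
    [NormedSpace ℂ E] [CompleteSpace E] {m : Measure X} {ψ : X → ℂ} (hψ : Integrable ψ m)
    (hψm : Measurable ψ) {f : X → E} (hf : (m.withDensityᵥ ψ).Integrable f) :
    (m.withDensityᵥ ψ).integral f (ContinuousLinearMap.lsmul ℝ ℂ).flip = ∫ x, ψ x • f x ∂m := by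
  set V := m.withDensityᵥ ψ with hV
  have hfinV : IsFiniteMeasure V.variation := isFiniteMeasure_variation V
  -- Where `ψ` vanishes this gives `u = 0`, so `‖ψ‖ • u = ψ` holds everywhere.
  let u : X → ℂ := fun x => ‖ψ x‖⁻¹ • ψ x
  have hu : Measurable u := hψm.norm.inv.smul hψm
  have hu1 : ∀ x, ‖u x‖ ≤ 1 := fun x => by
    simp only [u, norm_smul, norm_inv, norm_norm]
    exact inv_mul_le_one
  have hψu : ∀ x, ‖ψ x‖ • u x = ψ x := fun x => by
    rcases eq_or_ne (ψ x) 0 with h | h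
    · simp [u, h]
    · simp only [u, smul_smul]
      rw [mul_inv_cancel₀ (norm_ne_zero_iff.2 h), one_smul]
  have hui : ∀ {g : X → E}, Integrable g V.variation →
      Integrable (fun x => u x • g x) V.variation := fun hg =>
    hg.bdd_smul 1 hu.aestronglyMeasurable (Eventually.of_forall hu1)
  have key : V.integral f (ContinuousLinearMap.lsmul ℝ ℂ).flip = ∫ x, u x • f x ∂V.variation := by
    refine Integrable.induction (μ := V.variation)
      (fun f => V.integral f (ContinuousLinearMap.lsmul ℝ ℂ).flip = ∫ x, u x • f x ∂V.variation) ?_ ?_ ?_ ?_ hf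
    · intro c A hA _
      rw [VectorMeasure.integral_indicator_const c hA]
      have h1 : ∀ x, u x • A.indicator (fun _ => c) x = (A.indicator u x) • c := fun x => by
        by_cases hx : x ∈ A <;> simp [hx]
      simp only [h1]
      rw [integral_smul_const, integral_indicator hA]
      have h2 : V A = ∫ x in A, u x ∂V.variation := by
        rw [← integral_indicator hA, integral_variation_withDensityᵥ hψ hψm, hV, withDensityᵥ_apply hψ hA, ← integral_indicator hA]
        refine integral_congr_ae (Eventually.of_forall fun x => ?_)
        by_cases hx : x ∈ A <;> simp [hx, hψu]
      rw [← h2]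
      rfl
    · intro f g _ hf hg Pf Pg
      rw [VectorMeasure.integral_add hf hg, Pf, Pg, ← integral_add (hui hf) (hui hg)]
      simp only [Pi.add_apply, smul_add]
    · refine isClosed_eq VectorMeasure.continuous_integral ?_
      refine LipschitzWith.continuous (K := 1) (LipschitzWith.of_dist_le_mul fun f g => ?_)
      rw [dist_eq_norm, NNReal.coe_one, one_mul, L1.dist_eq_integral_dist,
        ← integral_sub (hui (L1.integrable_coeFn f)) (hui (L1.integrable_coeFn g))]
      simp only [dist_eq_norm]
      refine norm_integral_le_of_norm_le
        ((L1.integrable_coeFn f).sub (L1.integrable_coeFn g)).norm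
        (Eventually.of_forall fun x => ?_)
      rw [← smul_sub, norm_smul]
      exact mul_le_of_le_one_left (norm_nonneg _) (hu1 x)
    · intro f g hfg _ Pf
      rw [← VectorMeasure.integral_congr_ae hfg, Pf]
      refine integral_congr_ae ?_
      filter_upwards [hfg] with x hx
      rw [hx]
  rw [key, integral_variation_withDensityᵥ hψ hψm]
  refine integral_congr_ae (Eventually.of_forall fun x => ?_)
  simp only [← smul_assoc, hψu]

theorem weylTransform_withDensityᵥ {m : Measure Plane} {ψ : Plane → ℂ} (hψ : Integrable ψ m)
    (hψm : Measurable ψ) :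
    weylTransform (m.withDensityᵥ ψ) = superposition measurable_id hψ := by
  ext1 φ
  exact integral_withDensityᵥ_lsmul hψ hψm (integrable_schrodinger _ φ)

end Density

/-! ### Finite type and transversality of tangents -/

section FiniteType

/-- A smooth function is nonzero on a punctured neighbourhood of every point at which it vanishes
to finite order. -/
theorem eventually_ne_zero_of_iteratedDeriv_ne_zero {I : Set ℝ} (hI : IsOpen I) {t : ℝ}
    (ht : t ∈ I) (k : ℕ) {g : ℝ → ℝ} (hg : ContDiffOn ℝ ∞ g I) (hk : iteratedDeriv k g t ≠ 0) :
    ∀ᶠ s in 𝓝[≠] t, g s ≠ 0 := by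
  induction k generalizing g with
  | zero =>
    rw [iteratedDeriv_zero] at hk
    exact ((hg.continuousOn.continuousAt (hI.mem_nhds ht)).eventually_ne hk).filter_mono
      nhdsWithin_le_nhds
  | succ k ih =>
    rw [iteratedDeriv_succ'] at hk
    have h1 := ih (hg.deriv_of_isOpen hI (by simp)) hk
    -- If `g t ≠ 0`, continuity suffices. Otherwise Rolle applies: a further zero of `g` near `t`
    -- would force a zero of `g'` strictly between, against the induction hypothesis.
    rcases ne_or_eq (g t) 0 with h0 | h0
    · exact ((hg.continuousOn.continuousAt (hI.mem_nhds ht)).eventually_ne h0).filter_mono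
        nhdsWithin_le_nhds
    rw [eventually_nhdsWithin_iff] at h1 ⊢
    obtain ⟨ε, hε, hball⟩ := Metric.eventually_nhds_iff_ball.1 (h1.and (hI.mem_nhds ht))
    filter_upwards [Metric.ball_mem_nhds t hε] with s hs hst hgs
    have hcont : ∀ x ∈ Metric.ball t ε, ContinuousAt g x := fun x hx =>
      hg.continuousOn.continuousAt (hI.mem_nhds (hball x hx).2)
    have hsub : ∀ x ∈ Set.uIcc t s, x ∈ Metric.ball t ε := fun x hx =>
      ((convex_ball t ε).ordConnected.uIcc_subset (Metric.mem_ball_self hε) hs) hx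
    rcases lt_or_gt_of_ne hst with h | h
    · obtain ⟨x, hx, hx0⟩ := exists_deriv_eq_zero h (fun x hx => (hcont x (hsub x
        (Set.uIcc_of_ge h.le ▸ hx))).continuousWithinAt) (hgs.trans h0.symm)
      exact (hball x (hsub x (Set.uIcc_of_ge h.le ▸ Set.Ioo_subset_Icc_self hx))).1 hx.2.ne hx0
    · obtain ⟨x, hx, hx0⟩ := exists_deriv_eq_zero h (fun x hx => (hcont x (hsub x
        (Set.uIcc_of_le h.le ▸ hx))).continuousWithinAt) (h0.trans hgs.symm)
      exact (hball x (hsub x (Set.uIcc_of_le h.le ▸ Set.Ioo_subset_Icc_self hx))).1 hx.1.ne' hx0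

variable {M : Set Plane} {I I₁ I₂ : Set ℝ} {γ γ₁ γ₂ : ℝ → Plane}

theorem IsLocalParametrization.differentiableAt (h : IsLocalParametrization M I γ) {t : ℝ}
    (ht : t ∈ I) : DifferentiableAt ℝ γ t :=
  (h.contDiffOn.contDiffAt (h.isOpen_domain.mem_nhds ht)).differentiableAt (by simp)

theorem IsLocalParametrization.hasDerivAt_coord (h : IsLocalParametrization M I γ) {t : ℝ}
    (ht : t ∈ I) (i : Fin 2) : HasDerivAt (fun s => γ s i) (deriv γ t i) t :=
  (EuclideanSpace.proj i : Plane →L[ℝ] ℝ).hasFDerivAt.comp_hasDerivAt t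
    (h.differentiableAt ht).hasDerivAt

theorem inner_plane (u v : Plane) : inner ℝ u v = u 0 * v 0 + u 1 * v 1 := by
  simp [PiLp.inner_apply, Fin.sum_univ_two, mul_comm]

/-- On a curve of finite type, almost every tangent is transverse to a given direction. -/
theorem IsFiniteType.volume_inner_deriv_eq_zero (hft : IsFiniteType M)
    (h : IsLocalParametrization M I γ) {u : Plane} (hu : u ≠ 0) :
    volume {t | t ∈ I ∧ inner ℝ u (deriv γ t) = 0} = 0 := by
  refine measure_null_of_locally_null _ fun t ht => ?_
  set f : ℝ → ℝ := fun s => inner ℝ u (γ s) - inner ℝ u (γ t) with hf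
  have hfs : ContDiffOn ℝ ∞ f I := (contDiffOn_const.inner ℝ h.contDiffOn).sub contDiffOn_const
  have hfd : ∀ s ∈ I, deriv f s = inner ℝ u (deriv γ s) := fun s hs => by
    have h1 : HasDerivAt f (inner ℝ u (deriv γ s)) s := by
      have := ((innerSL ℝ u).hasFDerivAt.comp_hasDerivAt s
        (h.differentiableAt hs).hasDerivAt).sub_const (inner ℝ u (γ t))
      exact this
    exact h1.deriv
  -- The line is the one through `γ t` orthogonal to `u`. As `f t = 0`, the order `k` is positive,
  -- so `f'` vanishes at most to finite order at `t` and its zeros do not accumulate there.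
  obtain ⟨k, hk⟩ := hft I γ h t ht.1 u (inner ℝ u (γ t)) hu
  cases k with
  | zero => simp at hk
  | succ k =>
    rw [iteratedDeriv_succ'] at hk
    have h1 := eventually_ne_zero_of_iteratedDeriv_ne_zero h.isOpen_domain ht.1 k
      (hfs.deriv_of_isOpen h.isOpen_domain (by simp)) hk
    rw [eventually_nhdsWithin_iff] at h1
    refine ⟨{t}, ?_, measure_singleton t⟩
    refine mem_nhdsWithin_iff_eventually.2 ?_
    filter_upwards [h1] with s hs hsI
    by_contra hne
    exact hs hne ((hfd s hsI.1).trans hsI.2)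

/-- Pairs of parameters of a curve of finite type almost surely have transverse tangents. -/
theorem IsFiniteType.volume_parallel_eq_zero (hft : IsFiniteType M)
    (h₁ : IsLocalParametrization M I₁ γ₁) (h₂ : IsLocalParametrization M I₂ γ₂) :
    volume {z : ℝ × ℝ | z.1 ∈ I₁ ∧ z.2 ∈ I₂ ∧
      deriv γ₁ z.1 0 * deriv γ₂ z.2 1 - deriv γ₁ z.1 1 * deriv γ₂ z.2 0 = 0} = 0 := by
  have hd : ∀ (γ : ℝ → Plane) (i : Fin 2), Measurable fun t => deriv γ t i := fun γ i =>
    (EuclideanSpace.proj i : Plane →L[ℝ] ℝ).continuous.measurable.comp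
      (measurable_deriv γ)
  have hm : MeasurableSet {z : ℝ × ℝ | z.1 ∈ I₁ ∧ z.2 ∈ I₂ ∧
      deriv γ₁ z.1 0 * deriv γ₂ z.2 1 - deriv γ₁ z.1 1 * deriv γ₂ z.2 0 = 0} := by
    refine (measurable_fst h₁.isOpen_domain.measurableSet).inter
      ((measurable_snd h₂.isOpen_domain.measurableSet).inter (measurableSet_eq_fun ?_ ?_))
    · exact (((hd γ₁ 0).comp measurable_fst).mul ((hd γ₂ 1).comp measurable_snd)).sub
        (((hd γ₁ 1).comp measurable_fst).mul ((hd γ₂ 0).comp measurable_snd))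
    · exact measurable_const
  rw [Measure.volume_eq_prod, Measure.measure_prod_null hm]
  refine Eventually.of_forall fun s => ?_
  by_cases hs : s ∈ I₁
  -- For fixed `s` the determinant is the inner product of `γ₂'` with `γ₁' s` rotated by a right
  -- angle.
  · have hu : (!₂[-deriv γ₁ s 1, deriv γ₁ s 0] : Plane) ≠ 0 := fun h0 => by
      refine h₁.deriv_ne_zero s hs ?_
      have e0 := congrArg (fun p : Plane => p 0) h0
      have e1 := congrArg (fun p : Plane => p 1) h0
      ext i
      fin_cases i
      · simpa using e1
      · simpa using e0
    refine measure_mono_null (fun t ht => ?_) (hft.volume_inner_deriv_eq_zero h₂ hu)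
    obtain ⟨-, ht2, ht3⟩ := ht
    refine ⟨ht2, ?_⟩
    rw [inner_plane]
    simp only [Matrix.cons_val_zero, Matrix.cons_val_one]
    linarith
  · refine measure_mono_null (fun t ht => ?_) measure_empty
    exact hs ht.1

end FiniteType

/-! ### The difference map near transverse pairs -/

section LocalDiffeomorphism

/-- Preimages of null sets under local diffeomorphisms are locally null. -/
theorem exists_nhds_measure_inter_preimage_eq_zero {E : Type*} [NormedAddCommGroup E]
    [NormedSpace ℝ E] [FiniteDimensional ℝ E] [MeasurableSpace E] [BorelSpace E] (μ : Measure E)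
    [μ.IsAddHaarMeasure] {f : E → E} {f' : E ≃L[ℝ] E} {x : E} (hf : ContDiffAt ℝ 1 f x)
    (hf' : HasFDerivAt f (f' : E →L[ℝ] E) x) {N : Set E} (hN : μ N = 0) :
    ∃ U ∈ 𝓝 x, μ (U ∩ f ⁻¹' N) = 0 := by
  have : CompleteSpace E := FiniteDimensional.complete ℝ E
  let e := hf.toOpenPartialHomeomorph f hf' one_ne_zero
  have hx : x ∈ e.source := hf.mem_toOpenPartialHomeomorph_source hf' one_ne_zero
  -- The local inverse is differentiable near `f x`, and differentiable maps between spaces of equal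
  -- dimension send null sets to null sets.
  have hsymm : ContDiffAt ℝ 1 e.symm (f x) := hf.to_localInverse hf' one_ne_zero
  have hev : ∀ᶠ y in 𝓝 (f x), DifferentiableAt ℝ e.symm y :=
    (hsymm.eventually (by simp)).mono fun y hy => hy.differentiableAt (by simp)
  refine ⟨e.source ∩ {y | DifferentiableAt ℝ e.symm (f y)},
    inter_mem (e.open_source.mem_nhds hx) (hf.continuousAt.eventually hev), ?_⟩
  refine measure_mono_null (t := e.symm '' (N ∩ {y | DifferentiableAt ℝ e.symm y})) ?_ ?_
  · rintro y ⟨⟨hy, hd⟩, hyN⟩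
    exact ⟨f y, ⟨hyN, hd⟩, e.left_inv hy⟩
  · exact addHaar_image_eq_zero_of_differentiableOn_of_addHaar_eq_zero μ
      (fun y hy => hy.2.differentiableWithinAt) (measure_mono_null Set.inter_subset_left hN)

variable {M : Set Plane} {I₁ I₂ : Set ℝ} {γ₁ γ₂ : ℝ → Plane}

/-- Up to sign, the determinant in `hz` is the Jacobian of `(s, t) ↦ γ₂ t - γ₁ s`. -/
theorem exists_nhds_volume_difference_mem_eq_zero (h₁ : IsLocalParametrization M I₁ γ₁)
    (h₂ : IsLocalParametrization M I₂ γ₂) {N : Set Plane} (hN : volume N = 0) {z : ℝ × ℝ}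
    (hz₁ : z.1 ∈ I₁) (hz₂ : z.2 ∈ I₂)
    (hz : deriv γ₁ z.1 0 * deriv γ₂ z.2 1 - deriv γ₁ z.1 1 * deriv γ₂ z.2 0 ≠ 0) :
    ∃ U ∈ 𝓝 z, volume (U ∩ {w : ℝ × ℝ | γ₂ w.2 - γ₁ w.1 ∈ N}) = 0 := by
  let f : ℝ × ℝ → ℝ × ℝ := fun w => (γ₂ w.2 0 - γ₁ w.1 0, γ₂ w.2 1 - γ₁ w.1 1)
  have hcoord : ∀ {γ : ℝ → Plane} {t : ℝ} {I : Set ℝ}, IsLocalParametrization M I γ → t ∈ I →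
      ∀ i, ContDiffAt ℝ 1 (fun s => γ s i) t := fun h ht i =>
    (EuclideanSpace.proj i : Plane →L[ℝ] ℝ).contDiff.contDiffAt.comp _
      ((h.contDiffOn.contDiffAt (h.isOpen_domain.mem_nhds ht)).of_le (by simp))
  have hfs : ContDiffAt ℝ 1 f z :=
    (((hcoord h₂ hz₂ 0).comp z contDiffAt_snd).sub ((hcoord h₁ hz₁ 0).comp z contDiffAt_fst)).prodMk
      (((hcoord h₂ hz₂ 1).comp z contDiffAt_snd).sub ((hcoord h₁ hz₁ 1).comp z contDiffAt_fst))
  let A : ℝ × ℝ →L[ℝ] ℝ × ℝ :=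
    (deriv γ₂ z.2 0 • ContinuousLinearMap.snd ℝ ℝ ℝ
      - deriv γ₁ z.1 0 • ContinuousLinearMap.fst ℝ ℝ ℝ).prod
    (deriv γ₂ z.2 1 • ContinuousLinearMap.snd ℝ ℝ ℝ
      - deriv γ₁ z.1 1 • ContinuousLinearMap.fst ℝ ℝ ℝ)
  have hfA : HasFDerivAt f A z := by
    refine HasFDerivAt.prodMk (HasFDerivAt.sub ?_ ?_) (HasFDerivAt.sub ?_ ?_)
    · exact (h₂.hasDerivAt_coord hz₂ 0).comp_hasFDerivAt z hasFDerivAt_snd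
    · exact (h₁.hasDerivAt_coord hz₁ 0).comp_hasFDerivAt z hasFDerivAt_fst
    · exact (h₂.hasDerivAt_coord hz₂ 1).comp_hasFDerivAt z hasFDerivAt_snd
    · exact (h₁.hasDerivAt_coord hz₁ 1).comp_hasFDerivAt z hasFDerivAt_fst
  have hinj : Function.Injective (A : ℝ × ℝ →ₗ[ℝ] ℝ × ℝ) := by
    rw [injective_iff_map_eq_zero]
    rintro ⟨x, y⟩ hxy
    have e0 : deriv γ₂ z.2 0 * y - deriv γ₁ z.1 0 * x = 0 := congrArg Prod.fst hxy
    have e1 : deriv γ₂ z.2 1 * y - deriv γ₁ z.1 1 * x = 0 := congrArg Prod.snd hxy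
    have hx : (deriv γ₁ z.1 0 * deriv γ₂ z.2 1 - deriv γ₁ z.1 1 * deriv γ₂ z.2 0) * x = 0 := by
      linear_combination deriv γ₂ z.2 0 * e1 - deriv γ₂ z.2 1 * e0
    have hy : (deriv γ₁ z.1 0 * deriv γ₂ z.2 1 - deriv γ₁ z.1 1 * deriv γ₂ z.2 0) * y = 0 := by
      linear_combination deriv γ₁ z.1 0 * e1 - deriv γ₁ z.1 1 * e0
    exact Prod.ext ((mul_eq_zero.1 hx).resolve_left hz) ((mul_eq_zero.1 hy).resolve_left hz)
  let A' : (ℝ × ℝ) ≃L[ℝ] ℝ × ℝ :=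
    (LinearEquiv.ofInjectiveEndo (A : ℝ × ℝ →ₗ[ℝ] ℝ × ℝ) hinj).toContinuousLinearEquiv
  have hA' : (A' : ℝ × ℝ →L[ℝ] ℝ × ℝ) = A := by
    ext1 <;> rfl
  have hN' : volume (toPlane ⁻¹' N) = 0 :=
    measurePreserving_toPlane.quasiMeasurePreserving.preimage_null hN
  obtain ⟨U, hU, hU0⟩ := exists_nhds_measure_inter_preimage_eq_zero volume hfs
    (f' := A') (by rw [hA']; exact hfA) hN'
  refine ⟨U, hU, measure_mono_null (Set.inter_subset_inter_right _ fun w hw => ?_) hU0⟩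
  have : toPlane (f w) = γ₂ w.2 - γ₁ w.1 := by
    ext i
    fin_cases i <;> simp [toPlane, f]
  change toPlane (f w) ∈ N
  rw [this]
  exact hw

/-- Along two pieces of a curve of finite type, differences almost surely avoid a null set. -/
theorem IsFiniteType.volume_difference_mem_eq_zero (hft : IsFiniteType M)
    (h₁ : IsLocalParametrization M I₁ γ₁) (h₂ : IsLocalParametrization M I₂ γ₂)
    {N : Set Plane} (hN : volume N = 0) :
    volume {z : ℝ × ℝ | z.1 ∈ I₁ ∧ z.2 ∈ I₂ ∧ γ₂ z.2 - γ₁ z.1 ∈ N} = 0 := by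
  let D : ℝ × ℝ → ℝ := fun z =>
    deriv γ₁ z.1 0 * deriv γ₂ z.2 1 - deriv γ₁ z.1 1 * deriv γ₂ z.2 0
  have hgood : volume {z : ℝ × ℝ | z.1 ∈ I₁ ∧ z.2 ∈ I₂ ∧ γ₂ z.2 - γ₁ z.1 ∈ N ∧ D z ≠ 0} = 0 := by
    refine measure_null_of_locally_null _ fun z hz => ?_
    obtain ⟨U, hU, hU0⟩ :=
      exists_nhds_volume_difference_mem_eq_zero h₁ h₂ hN hz.1 hz.2.1 hz.2.2.2
    refine ⟨_, inter_mem_nhdsWithin _ hU, measure_mono_null ?_ hU0⟩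
    exact fun w hw => ⟨hw.2, hw.1.2.2.1⟩
  refine measure_mono_null (fun z hz => ?_)
    (measure_union_null hgood (hft.volume_parallel_eq_zero h₁ h₂))
  by_cases hD : D z = 0
  · exact Or.inr ⟨hz.1, hz.2.1, hD⟩
  · exact Or.inl ⟨hz.1, hz.2.1, hz.2.2, hD⟩

end LocalDiffeomorphism

/-! ### Transfer from parameters to arc length -/

section ArcLength

variable {M : Set Plane}

/-- Near each of its points, a smooth curve has finite length, and a set which is null for a local
parameter has length zero. -/
theorem IsSmoothCurve.exists_nhds_hausdorffMeasure (hM : IsSmoothCurve M) {p : Plane}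
    (hp : p ∈ M) :
    ∃ (I : Set ℝ) (γ : ℝ → Plane), IsLocalParametrization M I γ ∧
      ∃ V : Set Plane, IsOpen V ∧ p ∈ V ∧ Measure.hausdorffMeasure 1 (M ∩ V) ≠ ⊤ ∧
        ∀ A : Set Plane, volume {t | t ∈ I ∧ γ t ∈ A} = 0 →
          Measure.hausdorffMeasure 1 (M ∩ V ∩ A) = 0 := by
  obtain ⟨I, γ, h, t₀, ht₀, rfl⟩ := hM p hp
  refine ⟨I, γ, h, ?_⟩
  obtain ⟨V₀, hV₀, himage⟩ := h.isOpen_image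
  obtain ⟨r, hr, hrI⟩ := Metric.nhds_basis_closedBall.mem_iff.1 (h.isOpen_domain.mem_nhds ht₀)
  obtain ⟨L, hL⟩ := (h.contDiffOn.mono hrI).exists_lipschitzOnWith (by simp)
    (convex_closedBall t₀ r) (isCompact_closedBall t₀ r)
  -- The embedding property yields a plane neighbourhood in which this piece of `M` is reached only
  -- from parameters in the closed ball, where `γ` is Lipschitz. Lengths there are at most `L` times
  -- Lebesgue measure.
  have hnhds : {t : I | (t : ℝ) ∈ Metric.closedBall t₀ r} ∈ 𝓝 (⟨t₀, ht₀⟩ : I) :=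
    continuous_subtype_val.continuousAt.preimage_mem_nhds (Metric.closedBall_mem_nhds t₀ hr)
  rw [h.isEmbedding.isInducing.nhds_eq_comap] at hnhds
  obtain ⟨W, hW, hWr⟩ := hnhds
  obtain ⟨W', hW'W, hW', hpW'⟩ := mem_nhds_iff.1 hW
  have hpV₀ : γ t₀ ∈ V₀ := (himage ▸ Set.mem_image_of_mem γ ht₀ : γ t₀ ∈ M ∩ V₀).2
  have hsub : ∀ q ∈ M ∩ (W' ∩ V₀), ∃ t ∈ Metric.closedBall t₀ r, γ t = q := by
    rintro q ⟨hqM, hqW, hqV⟩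
    obtain ⟨t, ht, rfl⟩ : q ∈ γ '' I := himage ▸ ⟨hqM, hqV⟩
    exact ⟨t, hWr (show (⟨t, ht⟩ : I) ∈ (fun t : I => γ t) ⁻¹' W from hW'W hqW), rfl⟩
  have hle : ∀ S ⊆ Metric.closedBall t₀ r,
      Measure.hausdorffMeasure 1 (γ '' S) ≤ (L : ℝ≥0∞) * volume S := fun S hS => by
    have := (hL.mono hS).hausdorffMeasure_image_le zero_le_one
    rwa [ENNReal.rpow_one, hausdorffMeasure_real] at this
  refine ⟨W' ∩ V₀, hW'.inter hV₀, ⟨hpW', hpV₀⟩, ?_, fun A hA => ?_⟩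
  · refine ne_top_of_le_ne_top ?_ ((measure_mono hsub).trans (hle _ subset_rfl))
    exact ENNReal.mul_ne_top ENNReal.coe_ne_top measure_closedBall_lt_top.ne
  · refine measure_mono_null (t := γ '' {t | t ∈ Metric.closedBall t₀ r ∧ γ t ∈ A}) ?_ ?_
    · rintro q ⟨hq, hqA⟩
      obtain ⟨t, ht, rfl⟩ := hsub q hq
      exact ⟨t, ⟨ht, hqA⟩, rfl⟩
    · refine nonpos_iff_eq_zero.1 ((hle _ fun t ht => ht.1).trans (le_of_eq ?_))
      have : volume {t | t ∈ Metric.closedBall t₀ r ∧ γ t ∈ A} = 0 :=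
        measure_mono_null (fun t ht => And.intro (hrI ht.1) ht.2) hA
      rw [this, mul_zero]

theorem IsSmoothCurve.hausdorffMeasure_lt_top (hM : IsSmoothCurve M) {K : Set Plane}
    (hK : IsCompact K) (hKM : K ⊆ M) : Measure.hausdorffMeasure 1 K < ⊤ := by
  refine hK.measure_lt_top_of_nhdsWithin fun p hp => ?_
  obtain ⟨I, γ, -, V, hV, hpV, hfin, -⟩ := hM.exists_nhds_hausdorffMeasure (hKM hp)
  refine ⟨K ∩ V, inter_mem_nhdsWithin _ (hV.mem_nhds hpV), ?_⟩
  exact (measure_mono (Set.inter_subset_inter_left _ hKM)).trans_lt hfin.lt_top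

/-- The difference of two independent points of a compact part of a curve of finite type has an
absolutely continuous distribution. -/
theorem IsFiniteType.map_difference_absolutelyContinuous (hft : IsFiniteType M)
    (hM : IsSmoothCurve M) {K : Set Plane} (hK : IsCompact K) (hKM : K ⊆ M)
    [IsFiniteMeasure ((Measure.hausdorffMeasure 1).restrict K : Measure Plane)] :
    ((((Measure.hausdorffMeasure 1).restrict K : Measure Plane).prod
      ((Measure.hausdorffMeasure 1).restrict K)).map
        fun z : Plane × Plane => z.2 - z.1) ≪ volume := by
  set ν : Measure Plane := (Measure.hausdorffMeasure 1).restrict K with hν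
  have hKm : MeasurableSet K := hK.measurableSet
  have hδ : Measurable fun z : Plane × Plane => z.2 - z.1 := measurable_snd.sub measurable_fst
  refine Measure.AbsolutelyContinuous.mk fun N hNm hN => ?_
  rw [Measure.map_apply hδ hNm]
  set S := (fun z : Plane × Plane => z.2 - z.1) ⁻¹' N
  have hS : MeasurableSet S := hδ hNm
  have hKK : (ν.prod ν) (K ×ˢ K)ᶜ = 0 := by
    have h0 : ν Kᶜ = 0 := by rw [hν, Measure.restrict_apply hKm.compl]; simp
    rw [Set.compl_prod_eq_union]
    refine measure_union_null ?_ ?_ <;> rw [Measure.prod_prod, h0] <;> simp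
  refine measure_mono_null (t := (S ∩ K ×ˢ K) ∪ (K ×ˢ K)ᶜ) (fun z hz => ?_)
    (measure_union_null (measure_null_of_locally_null _ ?_) hKK)
  · by_cases hzK : z ∈ K ×ˢ K
    · exact Or.inl ⟨hz, hzK⟩
    · exact Or.inr hzK
  -- Nullity is local, so one chart around each of `p` and `q` is enough.
  rintro ⟨p, q⟩ ⟨-, hp, hq⟩
  obtain ⟨I₁, γ₁, h₁, V₁, hV₁, hpV₁, -, hnull₁⟩ := hM.exists_nhds_hausdorffMeasure (hKM hp)
  obtain ⟨I₂, γ₂, h₂, V₂, hV₂, hqV₂, -, hnull₂⟩ := hM.exists_nhds_hausdorffMeasure (hKM hq)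
  refine ⟨S ∩ V₁ ×ˢ V₂, ?_, ?_⟩
  · refine mem_nhdsWithin.2 ⟨V₁ ×ˢ V₂, hV₁.prod hV₂, ⟨hpV₁, hqV₂⟩, ?_⟩
    exact fun z hz => ⟨hz.2.1, hz.1⟩
  rw [Measure.measure_prod_null (hS.inter (hV₁.prod hV₂).measurableSet)]
  have hres : ∀ A : Set Plane, Measure.hausdorffMeasure 1 (M ∩ A) = 0 → ν A = 0 := fun A hA => by
    rw [hν, Measure.restrict_apply' hKm, Set.inter_comm]
    exact measure_mono_null (Set.inter_subset_inter_left _ hKM) hA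
  -- These are the `x` whose slice is not null. Fubini in parameter space shows that they have a
  -- null set of parameters in the first chart, hence zero length in `V₁`.
  let bad : Set Plane := {x | Measure.hausdorffMeasure 1 (M ∩ V₂ ∩ {y | y - x ∈ N}) ≠ 0}
  have hbad : ν (V₁ ∩ bad) = 0 := by
    refine hres _ ?_
    rw [← Set.inter_assoc]
    refine hnull₁ _ ?_
    have h0 := hft.volume_difference_mem_eq_zero h₁ h₂ hN
    rw [Measure.volume_eq_prod] at h0
    have h1 := Measure.measure_ae_null_of_prod_null h0
    refine measure_mono_null (fun s hs => ?_) (ae_iff.1 h1)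
    refine fun hs0 => hs.2 (hnull₂ _ ?_)
    refine measure_mono_null (fun t ht => ?_) hs0
    exact ⟨hs.1, ht.1, ht.2⟩
  refine measure_mono_null (fun x hx => ?_) hbad
  by_contra hxb
  refine hx ?_
  by_cases hxV : x ∈ V₁
  · have h2 : Measure.hausdorffMeasure 1 (M ∩ V₂ ∩ {y | y - x ∈ N}) = 0 := by
      by_contra h3
      exact hxb ⟨hxV, h3⟩
    refine measure_mono_null (fun y hy => ?_) (hres (V₂ ∩ {y | y - x ∈ N})
      (by rwa [← Set.inter_assoc]))
    exact ⟨hy.2.2, hy.1⟩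
  · refine measure_mono_null (fun y hy => ?_) measure_empty
    exact hxV hy.2.1

end ArcLength

theorem theorem4p1 (M : Set Plane) (hconn : IsConnected M) (hM : IsSmoothCurve M)
    (hft : IsFiniteType M) (ψ : Plane → ℂ) (hψ : ContDiff ℝ ∞ ψ)
    (hsupp : IsCompact (tsupport ψ ∩ M)) :
    Integrable ψ (arcLength M) ∧ IsCompactOperator (weylTransform (densityMeasure M ψ)) := by
  have hT : MeasurableSet (tsupport ψ) := (isClosed_tsupport ψ).measurableSet
  -- The length of `M` may be infinite. On the compact piece carrying `ψ` it is finite, and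
  -- restricting to that piece does not change the operator.
  have hres : (arcLength M).restrict (tsupport ψ)
      = (Measure.hausdorffMeasure 1).restrict (tsupport ψ ∩ M) := Measure.restrict_restrict hT
  have hfin : IsFiniteMeasure ((Measure.hausdorffMeasure 1).restrict (tsupport ψ ∩ M) :
      Measure Plane) :=
    isFiniteMeasure_restrict.2 (hM.hausdorffMeasure_lt_top hsupp Set.inter_subset_right).ne
  have hzero : ∀ p ∉ tsupport ψ, ψ p = 0 := fun p hp => image_eq_zero_of_notMem_tsupport hp
  have hintK : Integrable ψ ((Measure.hausdorffMeasure 1).restrict (tsupport ψ ∩ M)) := by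
    obtain ⟨C, hC⟩ := hsupp.exists_bound_of_continuousOn hψ.continuous.continuousOn
    exact Integrable.of_bound hψ.continuous.aestronglyMeasurable C
      (ae_restrict_of_forall_mem hsupp.measurableSet hC)
  have hint : Integrable ψ (arcLength M) := by
    rw [← integrableOn_iff_integrable_of_support_subset (subset_tsupport ψ), IntegrableOn, hres]
    exact hintK
  refine ⟨hint, ?_⟩
  have e : weylTransform (densityMeasure M ψ) = superposition measurable_id hintK := by
    rw [densityMeasure, weylTransform_withDensityᵥ hint hψ.continuous.measurable]
    ext1 φ
    rw [superposition_apply, superposition_apply, ← hres]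
    exact (setIntegral_eq_integral_of_forall_compl_eq_zero fun p hp => by
      rw [hzero p hp, zero_smul]).symm
  rw [e]
  exact isCompactOperator_superposition_id hintK
    (hft.map_difference_absolutelyContinuous hM hsupp Set.inter_subset_right)
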